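/- Let $D\subset\mathbb C$ be a bounded simply connected domain (non-empty, open), let $\Gamma\subset\mathbb C$ be a non-empty bounded set disjoint from $D$, and let $N\ge 1$ be an integer. A $\Gamma$-polynomial is a nonzero complex polynomial all of whose zeros lie in $\Gamma$ (nonzero constants are included), and "approximable by $\Gamma$-polynomials in $D$" means uniformly approximable by $\Gamma$-polynomials on each compact subset of $D$. The following are equivalent: (i) $\Gamma$ is a polynomial approximation set relative to $D$: every zero-free holomorphic function on $D$ is approximable by $\Gamma$-polynomials in $D$. (ii) For every $\zeta\in\Gamma$, the function $z\mapsto \frac{1}{(\zeta-z)^N}$ is approximable by $\Gamma$-polynomials in $D$. (iii) $\Gamma$ contains an $N$-asymptotically neutral family relative to $D$: there are natural numbers $n_j\to\infty$ and, for each $j$, points $\zeta_{j,1},\dots,\zeta_{j,n_j}\in\Gamma$ (not necessarily distinct) such that $$\sum_{k=1}^{n_j}\frac{1}{(\zeta_{j,k}-z)^N}\longrightarrow 0\qquad (j\to\infty)$$ uniformly on every compact subset of $D$. (iv) $\overline\Gamma$ divides the plane (that is, $\mathbb C\setminus\overline\Gamma$ is not connected), and $D$ lies in a bounded connected component of $\mathbb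 C\setminus\overline\Gamma$. -/

import Mathlib

/-- `p` is an `E`-polynomial: a nonzero complex polynomial all of whose zeros lie in `E`. -/
def IsPolyWithZerosIn (E : Set ℂ) (p : Polynomial ℂ) : Prop :=
  p ≠ 0 ∧ ∀ z : ℂ, p.IsRoot z → z ∈ E

/-- `f` can be approximated in `G` by `E`-polynomials, uniformly on compact subsets of `G`. -/
def ApproximableByPolys (E G : Set ℂ) (f : ℂ → ℂ) : Prop :=
  ∀ K : Set ℂ, IsCompact K → K ⊆ G → ∀ ε : ℝ, 0 < ε →
    ∃ p : Polynomial ℂ, IsPolyWithZerosIn E p ∧ ∀ z ∈ K, ‖f z - p.eval z‖ < ε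

/-- `E` is a polynomial approximation set relative to `G`: every zero-free holomorphic function
on `G` can be approximated by `E`-polynomials, uniformly on compact subsets of `G`. -/
def IsPolyApproxSet (E G : Set ℂ) : Prop :=
  ∀ f : ℂ → ℂ, DifferentiableOn ℂ f G → (∀ z ∈ G, f z ≠ 0) → ApproximableByPolys E G f

/-- The finite sequences `ζ j 0, …, ζ j (n j - 1)` (repetitions allowed), whose lengths `n j` tend
to infinity, form an `N`-asymptotically neutral family relative to `G`. -/
def IsAsympNeutral (N : ℕ) (G : Set ℂ) (n : ℕ → ℕ) (ζ : (j : ℕ) → Fin (n j) → ℂ) : Prop :=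
  Filter.Tendsto n Filter.atTop Filter.atTop ∧
    ∀ K : Set ℂ, IsCompact K → K ⊆ G →
      TendstoUniformlyOn (fun (j : ℕ) (z : ℂ) => ∑ k : Fin (n j), 1 / (ζ j k - z) ^ N)
        (fun _ => 0) Filter.atTop K

/-- `E` contains an `N`-asymptotically neutral family relative to `G`. -/
def ContainsAsympNeutral (N : ℕ) (E G : Set ℂ) : Prop :=
  ∃ (n : ℕ → ℕ) (ζ : (j : ℕ) → Fin (n j) → ℂ),
    (∀ j k, ζ j k ∈ E) ∧ IsAsympNeutral N G n ζ

/-- `F` divides the plane: its complement is not connected. -/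
def DividesPlane (F : Set ℂ) : Prop :=
  ¬ IsPreconnected Fᶜ

/-- `G` lies in a bounded connected component of the complement of `F`. -/
def LiesInBoundedComponent (G F : Set ℂ) : Prop :=
  ∃ w ∈ Fᶜ, Bornology.IsBounded (connectedComponentIn Fᶜ w) ∧ G ⊆ connectedComponentIn Fᶜ w

/-! The step from (i) to (ii) is a special case. For (ii) to (iii), multiplying an approximant of `1
/ (ζ₀ - z) ^ N` by `(ζ₀ - z) ^ N` gives a `Γ`-polynomial `Q` close to `1`; then `Q' / Q = -∑ 1 / (ζ
- z)` over the roots is small, and differentiation yields the exponent `N` (`exists_sum_one_div_lt`,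
`exists_sum_one_div_pow_lt`). For (iii) to (iv), a limit functional `Λ` of averages over the poles
has mass `1`, and `Λ (1 / (z - ·) ^ N)` vanishes on `D`, hence on the component of the complement of
`closure Γ` containing `D`; it behaves like `z ^ (-N)` at infinity, so that component is bounded.

The step from (iv) to (i) is the hard one. It suffices to approximate `-f' / f` by sums of Cauchy
kernels `1 / (ζ - z)` with poles in `Γ`, since a logarithmic derivative determines a function up to
a constant factor. Real nonnegative coefficients come from duality: if a functional has nonnegative
real part on kernels whose poles surround `K`, its Cauchy transform vanishes near infinity by the
maximum principle, hence off `K`, and by Cauchy–Pompeiu the functional annihilates all functions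
holomorphic near `K`.

The coefficients must then become integers. Cauchy kernels lie exponentially close to
low-dimensional subspaces, so all but a bounded number of coefficients can be rounded at small cost
(`HasExpWidth.exists_few_fractional`). The remaining fractional weights are carried along chains of
closely spaced poles to a single pole, where they add up nearly to an integer
(`HasExpWidth.exists_mem_addSubmonoid_closure`). The chains require a chain connected part of
`closure Γ` that still surrounds `D`; it is found with the criterion that a compact set separates
`p` from infinity exactly when `z - p` has no continuous logarithm on it. -/

/-! ### Separation in the plane through continuous logarithms -/

/-- `z ↦ z - p` has a continuous logarithm on `A`. -/
def HasContLogOn (A : Set ℂ) (p : ℂ) : Prop :=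
  ∃ l : ℂ → ℂ, ContinuousOn l A ∧ ∀ z ∈ A, Complex.exp (l z) = z - p

theorem HasContLogOn.mono {A B : Set ℂ} {p : ℂ} (h : HasContLogOn B p) (hAB : A ⊆ B) :
    HasContLogOn A p := by
  obtain ⟨l, hl, he⟩ := h
  exact ⟨l, hl.mono hAB, fun z hz => he z (hAB hz)⟩

theorem IsSimplyConnected.hasContLogOn {D : Set ℂ} (hD : IsOpen D) (hs : IsSimplyConnected D)
    {p : ℂ} (hp : p ∉ D) : HasContLogOn D p := by
  obtain ⟨f, hf, he⟩ := Complex.exists_continuousOn_eqOn_exp_comp hs hD (g := fun z => z - p)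
    (by fun_prop) (by
      rintro ⟨z, hz, h⟩
      rw [sub_eq_zero] at h
      exact hp (h ▸ hz))
  exact ⟨f, hf, he⟩

theorem frontier_connectedComponentIn_compl_subset {A : Set ℂ} (hA : IsClosed A) (p : ℂ) :
    frontier (connectedComponentIn Aᶜ p) ⊆ A := by
  intro x hx
  by_contra hxA
  have hop : ∀ y, IsOpen (connectedComponentIn Aᶜ y) := fun y => hA.isOpen_compl.connectedComponentIn
  have hxV : x ∈ connectedComponentIn Aᶜ x := mem_connectedComponentIn hxA
  obtain ⟨y, hy1, hy2⟩ := mem_closure_iff.1 hx.1 _ (hop x) hxV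
  have h1 := connectedComponentIn_eq hy1
  have h2 := connectedComponentIn_eq hy2
  rw [(hop p).frontier_eq] at hx
  exact hx.2 (by rw [h2, ← h1]; exact hxV)

/-- Along the circle, the logarithm minus `t * I` takes values in one coset of `2πiℤ` and so is
constant, whereas a full turn would change it by `2πi`. -/
theorem not_exp_eq_sub_on_circle {m : ℂ → ℂ} (hm : Continuous m) {p : ℂ} {R : ℝ}
    (hR : 0 < R) (h : ∀ z, ‖z - p‖ = R → Complex.exp (m z) = z - p) : False := by
  have hnorm : ∀ t : ℝ, ‖(p + R * Complex.exp (t * Complex.I)) - p‖ = R := by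
    intro t
    rw [add_sub_cancel_left, norm_mul, Complex.norm_exp_ofReal_mul_I, Complex.norm_real,
      Real.norm_of_nonneg hR.le, mul_one]
  let k : ℝ → ℂ := fun t => m (p + R * Complex.exp (t * Complex.I)) - t * Complex.I
  have hk : Continuous k := by fun_prop
  have hexp : ∀ t, Complex.exp (k t) = R := by
    intro t
    simp only [k]
    rw [Complex.exp_sub, h _ (hnorm t), add_sub_cancel_left, mul_div_cancel_right₀ _ (Complex.exp_ne_zero _)]
  have him : ∀ t, ∃ n : ℤ, k t - k 0 = n * (2 * Real.pi * Complex.I) := by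
    intro t
    obtain ⟨n, hn⟩ := Complex.exp_eq_exp_iff_exists_int.1 ((hexp t).trans (hexp 0).symm)
    exact ⟨n, by rw [hn]; ring⟩
  choose n hn using him
  let g : ℝ → ℝ := fun t => ((k t - k 0) / (2 * Real.pi * Complex.I)).re
  have hpi : (2 * Real.pi * Complex.I : ℂ) ≠ 0 := by simp [Real.pi_ne_zero]
  have hgn : ∀ t, g t = n t := by
    intro t
    simp only [g]
    rw [hn t, mul_div_cancel_right₀ _ hpi]
    simp
  have hgc : Continuous g := by
    simp only [g]
    fun_prop
  have hnc : Continuous n := by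
    refine Int.isClosedEmbedding_coe_real.isInducing.continuous_iff.2 ?_
    have : (fun x : ℤ => (x : ℝ)) ∘ n = g := by
      ext t; simp [hgn]
    exact this ▸ hgc
  have h0 : n (2 * Real.pi) = n 0 := PreconnectedSpace.constant inferInstance hnc
  have h1 := hn (2 * Real.pi)
  have h2 := hn 0
  rw [h0, ← h2, sub_left_inj] at h1
  simp only [k] at h1
  have h3 : Complex.exp (((2 * Real.pi : ℝ) : ℂ) * Complex.I) = Complex.exp (((0 : ℝ) : ℂ) * Complex.I) := by
    push_cast
    rw [Complex.exp_two_pi_mul_I]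
    simp
  rw [h3] at h1
  have : ((2 * Real.pi : ℝ) : ℂ) * Complex.I = 0 := by
    have := h1
    simp only [Complex.ofReal_zero, zero_mul, sub_zero] at this
    linear_combination -this
  apply hpi
  push_cast at this
  exact this

/-- If a compact set separates `p` from infinity, there is no continuous logarithm of `z - p`
on it. -/
theorem not_hasContLogOn_of_isBounded {A : Set ℂ} (hA : IsCompact A) {p : ℂ} (hp : p ∉ A)
    (hb : Bornology.IsBounded (connectedComponentIn Aᶜ p)) : ¬ HasContLogOn A p := by
  classical
  rintro ⟨l, hl, he⟩
  set U := connectedComponentIn Aᶜ p with hU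
  have hpU : p ∈ U := mem_connectedComponentIn hp
  obtain ⟨L, hL⟩ := ContinuousMap.exists_restrict_eq hA.isClosed
    (⟨A.domRestrict l, continuousOn_iff_continuous_domRestrict.mp hl⟩ : C(A, ℂ))
  have hLl : ∀ z ∈ A, L z = l z := fun z hz => congr($hL ⟨z, hz⟩)
  -- Replacing `z - p` inside `U` by the exponential of a Tietze extension of `l` removes its zero.
  -- The resulting zero-free function on the plane has a logarithm, yet still equals `z - p` on a
  -- large circle.
  let r : ℂ → ℂ := U.piecewise (fun z => Complex.exp (L z)) (fun z => z - p)
  have hr : Continuous r := by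
    refine continuous_piecewise ?_ ?_ ?_
    · intro z hz
      have hzA := frontier_connectedComponentIn_compl_subset hA.isClosed p hz
      simp only [hLl z hzA, he z hzA]
    · fun_prop
    · fun_prop
  have hr0 : ∀ z, r z ≠ 0 := by
    intro z
    by_cases hz : z ∈ U
    · simp [r, hz, Complex.exp_ne_zero]
    · simp only [r, Set.piecewise_eq_of_notMem _ _ _ hz]
      intro h
      rw [sub_eq_zero] at h
      exact hz (h ▸ hpU)
  have hsc : IsSimplyConnected (Set.univ : Set ℂ) := by
    have : ContractibleSpace (Set.univ : Set ℂ) :=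
      (Homeomorph.Set.univ ℂ).contractibleSpace
    exact (inferInstance : SimplyConnectedSpace (Set.univ : Set ℂ))
  obtain ⟨m, hm, hme⟩ := Complex.exists_continuousOn_eqOn_exp_comp hsc isOpen_univ
    hr.continuousOn (by rintro ⟨z, -, h⟩; exact hr0 z h)
  obtain ⟨R, hR, hUR⟩ := hb.subset_ball_lt 0 p
  refine not_exp_eq_sub_on_circle (continuousOn_univ.1 hm) hR (p := p) fun z hz => ?_
  have hzU : z ∉ U := by
    intro h
    have := hUR h
    rw [Metric.mem_ball, dist_eq_norm, hz] at this
    exact lt_irrefl _ this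
  have := hme (Set.mem_univ z)
  simpa [r, hzU] using this

/-- Makes the existence of a logarithm locally constant in `p`: the quotient `(z - p') / (z - p)`
stays in the unit disc about `1`, where the principal logarithm is continuous. -/
theorem HasContLogOn.of_near {A : Set ℂ} {p p' : ℂ} (h : HasContLogOn A p)
    (hlt : ∀ z ∈ A, ‖p - p'‖ < ‖z - p‖) : HasContLogOn A p' := by
  obtain ⟨l, hl, he⟩ := h
  have hne : ∀ z ∈ A, z - p ≠ 0 := fun z hz => by
    have := (norm_nonneg _).trans_lt (hlt z hz)
    exact norm_pos_iff.1 this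
  have hs : ∀ z ∈ A, 1 + (p - p') / (z - p) ∈ Complex.slitPlane := by
    intro z hz
    refine Complex.mem_slitPlane_of_norm_lt_one ?_
    rw [norm_div, div_lt_one ((norm_nonneg _).trans_lt (hlt z hz))]
    exact hlt z hz
  refine ⟨fun z => l z + Complex.log (1 + (p - p') / (z - p)), ?_, fun z hz => ?_⟩
  · refine hl.add (ContinuousOn.clog ?_ hs)
    exact continuousOn_const.add (continuousOn_const.div (by fun_prop) hne)
  · rw [Complex.exp_add, he z hz, Complex.exp_log (Complex.slitPlane_ne_zero (hs z hz))]
    have := hne z hz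
    field_simp
    ring

theorem hasContLogOn_of_norm_lt {A : Set ℂ} {p : ℂ} (h : ∀ z ∈ A, ‖z‖ < ‖p‖) :
    HasContLogOn A p := by
  rcases A.eq_empty_or_nonempty with rfl | ⟨a, ha⟩
  · exact ⟨0, continuousOn_empty _, by simp⟩
  have hp : p ≠ 0 := norm_pos_iff.1 ((norm_nonneg _).trans_lt (h a ha))
  have hs : ∀ z ∈ A, 1 + (-z / p) ∈ Complex.slitPlane := by
    intro z hz
    refine Complex.mem_slitPlane_of_norm_lt_one ?_
    rw [norm_div, norm_neg, div_lt_one ((norm_nonneg _).trans_lt (h z hz))]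
    exact h z hz
  refine ⟨fun z => Complex.log (-p) + Complex.log (1 + (-z / p)), ?_, fun z hz => ?_⟩
  · exact continuousOn_const.add (ContinuousOn.clog (by fun_prop) hs)
  · rw [Complex.exp_add, Complex.exp_log (neg_ne_zero.2 hp),
      Complex.exp_log (Complex.slitPlane_ne_zero (hs z hz))]
    field_simp
    ring

/-- If a compact set does not separate `p` from infinity, then `z - p` has a continuous logarithm
on it. -/
theorem hasContLogOn_of_not_isBounded {A : Set ℂ} (hA : IsCompact A) {p : ℂ} (hp : p ∉ A)
    (hb : ¬ Bornology.IsBounded (connectedComponentIn Aᶜ p)) : HasContLogOn A p := by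
  obtain ⟨R, hR⟩ := hA.isBounded.exists_norm_le
  set W := connectedComponentIn Aᶜ p with hW
  have hWo : IsOpen W := hA.isClosed.isOpen_compl.connectedComponentIn
  have hWA : W ⊆ Aᶜ := connectedComponentIn_subset _ _
  obtain ⟨w, hwW, hwR⟩ : ∃ w ∈ W, R < ‖w‖ := by
    by_contra! hcon
    exact hb (Metric.isBounded_closedBall.subset fun z hz => mem_closedBall_zero_iff.2 (hcon z hz))
  have hdist : ∀ q ∈ W, ∃ ε > 0, Metric.ball q ε ⊆ Aᶜ := fun q hq =>
    Metric.isOpen_iff.1 hA.isClosed.isOpen_compl q (hWA hq)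
  have hnear : ∀ q ∈ W, ∃ ε > 0, ∀ q' ∈ Metric.ball q ε,
      (HasContLogOn A q ↔ HasContLogOn A q') := by
    intro q hq
    obtain ⟨ε, hε, hball⟩ := hdist q hq
    have hz : ∀ z ∈ A, ε ≤ ‖z - q‖ := by
      intro z hz
      by_contra! hlt
      exact hball (by rwa [Metric.mem_ball, dist_eq_norm]) hz
    -- Half the distance bound, so that `HasContLogOn.of_near` applies in both directions.
    refine ⟨ε / 2, by positivity, fun q' hq' => ⟨fun h => h.of_near fun z hzA => ?_,
      fun h => h.of_near fun z hzA => ?_⟩⟩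
    all_goals
      rw [Metric.mem_ball, dist_eq_norm] at hq'
      have h1 := hz z hzA
    · rw [norm_sub_rev]; linarith
    · have h2 : ‖z - q‖ ≤ ‖z - q'‖ + ‖q' - q‖ := by
        simpa using norm_add_le (z - q') (q' - q)
      linarith
  have hpre : IsPreconnected W := isPreconnected_connectedComponentIn
  by_contra hcon
  -- Having a logarithm is an open and closed condition on the connected set `W`, and it holds at a
  -- point `w` far from `A`.
  obtain ⟨x, hx, hx1, hx2⟩ := hpre {q | q ∈ W ∧ HasContLogOn A q} {q | q ∈ W ∧ ¬ HasContLogOn A q}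
    (by
      refine isOpen_iff_mem_nhds.2 fun q hq => ?_
      obtain ⟨ε, hε, h⟩ := hnear q hq.1
      filter_upwards [Metric.ball_mem_nhds q hε, hWo.mem_nhds hq.1] with q' h1 h2
      exact ⟨h2, (h q' h1).1 hq.2⟩)
    (by
      refine isOpen_iff_mem_nhds.2 fun q hq => ?_
      obtain ⟨ε, hε, h⟩ := hnear q hq.1
      filter_upwards [Metric.ball_mem_nhds q hε, hWo.mem_nhds hq.1] with q' h1 h2
      exact ⟨h2, fun h3 => hq.2 ((h q' h1).2 h3)⟩)
    (fun q hq => by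
      by_cases h : HasContLogOn A q
      · exact Or.inl ⟨hq, h⟩
      · exact Or.inr ⟨hq, h⟩)
    ⟨w, hwW, hwW, hasContLogOn_of_norm_lt fun z hz => (hR z hz).trans_lt hwR⟩
    ⟨p, mem_connectedComponentIn hp, mem_connectedComponentIn hp, hcon⟩
  exact hx2.2 hx1.2

theorem isPreconnected_setOf_lt_norm {R : ℝ} (hR : 0 < R) : IsPreconnected {z : ℂ | R < ‖z‖} := by
  have h : {z : ℂ | R < ‖z‖} = Complex.exp '' {w : ℂ | Real.log R < w.re} := by
    ext z
    constructor
    · intro hz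
      have hz0 : z ≠ 0 := norm_pos_iff.1 (hR.trans hz)
      refine ⟨Complex.log z, ?_, Complex.exp_log hz0⟩
      simpa [Complex.log_re] using Real.log_lt_log hR hz
    · rintro ⟨w, hw, rfl⟩
      rw [Set.mem_ofPred_eq, Complex.norm_exp]
      exact (Real.log_lt_iff_lt_exp hR).1 hw
  rw [h]
  exact (convex_halfSpace_re_gt _).isPreconnected.image _ Complex.continuous_exp.continuousOn

theorem connectedComponentIn_compl_eq_of_lt_norm {A : Set ℂ} {R : ℝ} (hR : 0 < R)
    (hA : ∀ z ∈ A, ‖z‖ ≤ R) {p w : ℂ}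
    (hp : ¬ Bornology.IsBounded (connectedComponentIn Aᶜ p)) (hw : R < ‖w‖) :
    w ∈ connectedComponentIn Aᶜ p := by
  obtain ⟨v, hv, hvR⟩ : ∃ v ∈ connectedComponentIn Aᶜ p, R < ‖v‖ := by
    by_contra! hcon
    exact hp (Metric.isBounded_closedBall.subset fun z hz => mem_closedBall_zero_iff.2 (hcon z hz))
  have hsub : {z : ℂ | R < ‖z‖} ⊆ Aᶜ := fun z hz h => absurd (hA z h) (not_le.2 hz)
  rw [connectedComponentIn_eq hv]
  exact (isPreconnected_setOf_lt_norm hR).subset_connectedComponentIn hvR hsub hw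

/-- A compact subset of a simply connected domain is contained in one with connected complement. -/
theorem IsSimplyConnected.exists_isCompact_preconnected_compl {D : Set ℂ} (hD : IsOpen D)
    (hs : IsSimplyConnected D) {K : Set ℂ} (hK : IsCompact K) (hKD : K ⊆ D) :
    ∃ K' : Set ℂ, IsCompact K' ∧ K ⊆ K' ∧ K' ⊆ D ∧ IsPreconnected K'ᶜ := by
  obtain ⟨R, hR0, hR⟩ := hK.isBounded.exists_pos_norm_le
  set w : ℂ := ((R + 1 : ℝ) : ℂ) with hw
  have hwR : R < ‖w‖ := by
    rw [hw, Complex.norm_real, Real.norm_of_nonneg (by positivity)]; linarith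
  set V := connectedComponentIn Kᶜ w with hV
  have hout : {z : ℂ | R < ‖z‖} ⊆ V :=
    (isPreconnected_setOf_lt_norm hR0).subset_connectedComponentIn hwR
      fun z hz h => absurd (hR z h) (not_le.2 hz)
  have hVo : IsOpen V := hK.isClosed.isOpen_compl.connectedComponentIn
  -- `Vᶜ` is `K` with its holes filled. A hole containing a point outside `D` would contradict the
  -- logarithm available on all of `D`.
  refine ⟨Vᶜ, ?_, ?_, ?_, ?_⟩
  · refine Metric.isCompact_of_isClosed_isBounded hVo.isClosed_compl
      (Metric.isBounded_closedBall.subset (t := Metric.closedBall 0 R) fun z hz => ?_)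
    rw [mem_closedBall_zero_iff]
    by_contra! h
    exact hz (hout h)
  · exact Set.subset_compl_comm.1 (connectedComponentIn_subset _ _)
  · intro p hp
    by_contra hpD
    have hpK : p ∉ K := fun h => hpD (hKD h)
    refine not_hasContLogOn_of_isBounded hK hpK ?_ ((hs.hasContLogOn hD hpD).mono hKD)
    by_contra hcon
    have := connectedComponentIn_compl_eq_of_lt_norm hR0 hR hcon hwR
    exact hp (by rw [hV, ← connectedComponentIn_eq this]; exact mem_connectedComponentIn hpK)
  · rw [compl_compl]
    exact isPreconnected_connectedComponentIn

/-! ### Chain connected separating sets -/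

/-- Any two points of `A` are joined by a chain of points of `A` with steps shorter than `δ`. -/
def IsChainConnected {X : Type*} [PseudoMetricSpace X] (A : Set X) (δ : ℝ) : Prop :=
  ∀ a ∈ A, ∀ b ∈ A, Relation.ReflTransGen (fun x y => x ∈ A ∧ y ∈ A ∧ dist x y < δ) a b

/-- A compact set separating `p` from infinity has a closed chain connected subset
separating `p` from infinity. -/
theorem exists_isChainConnected_separating {F : Set ℂ} (hF : IsCompact F) {p : ℂ} (hp : p ∉ F)
    (hb : Bornology.IsBounded (connectedComponentIn Fᶜ p)) {δ : ℝ} (hδ : 0 < δ) :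
    ∃ A ⊆ F, IsClosed A ∧ IsChainConnected A δ ∧
      Bornology.IsBounded (connectedComponentIn Aᶜ p) := by
  classical
  let r : ℂ → ℂ → Prop := fun x y => x ∈ F ∧ y ∈ F ∧ dist x y < δ
  let cls : ℂ → Set ℂ := fun x => {y | Relation.ReflTransGen r x y}
  have hsymm : Std.Symm r := ⟨fun x y h => ⟨h.2.1, h.1, by rw [dist_comm]; exact h.2.2⟩⟩
  have hrsymm : ∀ {x y}, Relation.ReflTransGen r x y → Relation.ReflTransGen r y x := by
    intro x y h
    exact Relation.ReflTransGen.stdSymm.symm _ _ h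
  have hclsF : ∀ x ∈ F, cls x ⊆ F := by
    intro x hx y hy
    induction hy with
    | refl => exact hx
    | tail _ h _ => exact h.2.1
  have hcls_eq : ∀ x y, Relation.ReflTransGen r x y → cls x = cls y := by
    intro x y h
    ext z
    exact ⟨fun hz => (hrsymm h).trans hz, fun hz => h.trans hz⟩
  have hclosed : ∀ x ∈ F, IsClosed (cls x) := by
    intro x hx
    refine isClosed_of_closure_subset fun y hy => ?_
    have hyF : y ∈ F := hF.isClosed.closure_subset_iff.2 (hclsF x hx) hy
    obtain ⟨z, hz, hzy⟩ := Metric.mem_closure_iff.1 hy δ hδ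
    exact Relation.ReflTransGen.tail hz ⟨hclsF x hx hz, hyF, by rwa [dist_comm]⟩
  have hchain : ∀ x ∈ F, IsChainConnected (cls x) δ := by
    intro x hx a ha b hb
    have hab : Relation.ReflTransGen r a b := (hrsymm ha).trans hb
    clear hb
    induction hab with
    | refl => exact Relation.ReflTransGen.refl
    | tail h1 h2 ih =>
      exact ih.tail ⟨ha.trans h1, (ha.trans h1).tail h2, h2.2.2⟩
  -- If no chain class separated `p` from infinity, each would carry a logarithm; distinct classes
  -- are at least `δ` apart, so these glue to a continuous logarithm on `F`.
  by_contra hcon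
  push Not at hcon
  have hlog : ∀ x ∈ F, HasContLogOn (cls x) p := fun x hx =>
    hasContLogOn_of_not_isBounded (hF.of_isClosed_subset (hclosed x hx) (hclsF x hx))
      (fun h => hp (hclsF x hx h)) (hcon _ (hclsF x hx) (hclosed x hx) (hchain x hx))
  refine not_hasContLogOn_of_isBounded hF hp hb ?_
  let L : Set ℂ → ℂ → ℂ := fun A => if h : HasContLogOn A p then h.choose else 0
  have hL : ∀ A, HasContLogOn A p → ContinuousOn (L A) A ∧ ∀ z ∈ A, Complex.exp (L A z) = z - p := by
    intro A h
    simp only [L, dif_pos h]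
    exact h.choose_spec
  refine ⟨fun z => L (cls z) z, ?_, fun z hz => (hL _ (hlog z hz)).2 z Relation.ReflTransGen.refl⟩
  intro x hx
  have h1 := (hL _ (hlog x hx)).1 x Relation.ReflTransGen.refl
  have hball : ∀ y ∈ F ∩ Metric.ball x δ, Relation.ReflTransGen r x y := fun y hy =>
    Relation.ReflTransGen.single ⟨hx, hy.1, by rw [dist_comm]; exact hy.2⟩
  have h2 : ContinuousWithinAt (fun z => L (cls z) z) (F ∩ Metric.ball x δ) x := by
    refine (h1.mono (s := F ∩ Metric.ball x δ) hball).congr (fun y hy => ?_) rfl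
    rw [hcls_eq x y (hball y hy)]
  exact (continuousWithinAt_inter (Metric.ball_mem_nhds x hδ)).1 h2

/-! ### Exponential widths and rounding of coefficients -/

/-- The set `T` is approximated to order `C / 2 ^ q` by a subspace of dimension at most `B * q`. -/
def HasExpWidth {X : Type*} [NormedAddCommGroup X] [NormedSpace ℝ X] (T : Set X) (B : ℕ) (C : ℝ) :
    Prop :=
  ∀ q : ℕ, ∃ W : Submodule ℝ X, FiniteDimensional ℝ W ∧ Module.finrank ℝ W ≤ B * q ∧
    ∀ x ∈ T, ∃ w ∈ W, ‖x - w‖ ≤ C * (1 / 2) ^ q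

section Rounding

variable {X : Type*} [NormedAddCommGroup X] [NormedSpace ℝ X]

theorem HasExpWidth.norm_le {T : Set X} {B : ℕ} {C : ℝ} (h : HasExpWidth T B C) {x : X}
    (hx : x ∈ T) : ‖x‖ ≤ C := by
  -- At `q = 0` the subspace is trivial, so the approximation error is the norm itself.
  obtain ⟨W, hW, hr, ha⟩ := h 0
  obtain ⟨w, hw, hle⟩ := ha x hx
  have : W = ⊥ := Submodule.finrank_eq_zero.1 (by omega)
  rw [this, Submodule.mem_bot] at hw
  simpa [hw] using hle

theorem HasExpWidth.sub {T : Set X} {B : ℕ} {C : ℝ} (h : HasExpWidth T B C) :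
    HasExpWidth {z : X | ∃ x ∈ T, ∃ y ∈ T, z = x - y} B (2 * C) := fun q => by
  obtain ⟨W, hW, hr, ha⟩ := h q
  refine ⟨W, hW, hr, ?_⟩
  rintro z ⟨x, hx, y, hy, rfl⟩
  obtain ⟨w, hw, hle⟩ := ha x hx
  obtain ⟨w', hw', hle'⟩ := ha y hy
  refine ⟨w - w', W.sub_mem hw hw', ?_⟩
  calc ‖x - y - (w - w')‖ = ‖(x - w) - (y - w')‖ := by congr 1; abel
    _ ≤ ‖x - w‖ + ‖y - w'‖ := norm_sub_le _ _
    _ ≤ 2 * C * (1 / 2) ^ q := by linarith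

/-- The extra coordinate `1` lets the rounding of coefficients control their total mass together
with the vector sum. -/
theorem HasExpWidth.prodMk_one {T : Set X} {B : ℕ} {C : ℝ} (h : HasExpWidth T B C) :
    HasExpWidth ((fun x : X => ((1 : ℝ), x)) '' T) (B + 1) (max 1 C) := fun q => by
  rcases Nat.eq_zero_or_pos q with rfl | hq
  · refine ⟨⊥, inferInstance, by simp, ?_⟩
    rintro _ ⟨x, hx, rfl⟩
    refine ⟨0, Submodule.zero_mem _, ?_⟩
    have := h.norm_le hx
    simp only [sub_zero, pow_zero, mul_one, Prod.norm_def, norm_one]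
    exact max_le_max le_rfl this
  · obtain ⟨W, hW, hr, ha⟩ := h q
    let e : (ℝ × W) →ₗ[ℝ] (ℝ × X) := LinearMap.prodMap LinearMap.id W.subtype
    refine ⟨LinearMap.range e, inferInstance, ?_, ?_⟩
    · calc Module.finrank ℝ (LinearMap.range e) ≤ Module.finrank ℝ (ℝ × W) :=
            LinearMap.finrank_range_le e
        _ = 1 + Module.finrank ℝ W := by rw [Module.finrank_prod, Module.finrank_self]
        _ ≤ (B + 1) * q := by rw [add_mul]; omega
    · rintro _ ⟨x, hx, rfl⟩
      obtain ⟨w, hw, hle⟩ := ha x hx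
      refine ⟨(1, w), ⟨(1, ⟨w, hw⟩), rfl⟩, ?_⟩
      rw [Prod.mk_sub_mk, Prod.norm_def, sub_self, norm_zero]
      refine max_le ?_ (hle.trans ?_)
      · positivity
      · gcongr
        exact le_max_right _ _

/-- More vectors than the dimension of a subspace near them admit an almost-relation. -/
theorem exists_almost_relation {ι : Type*} {v : ι → X} {s : Finset ι} {W : Submodule ℝ X}
    [FiniteDimensional ℝ W] {e : ℝ} (hW : Module.finrank ℝ W < s.card)
    (hv : ∀ i ∈ s, ∃ w ∈ W, ‖v i - w‖ ≤ e) :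
    ∃ a : ι → ℝ, (∃ i ∈ s, |a i| = 1) ∧ (∀ i ∉ s, a i = 0) ∧ ‖∑ i ∈ s, a i • v i‖ ≤ s.card * e := by
  classical
  choose! w hwW hw using hv
  let u : s → W := fun i => ⟨w i, hwW i i.2⟩
  have hdep : ¬ LinearIndependent ℝ u := fun h => by
    have := h.fintype_card_le_finrank
    rw [Fintype.card_coe] at this
    omega
  obtain ⟨g, hg, i0, hi0⟩ := Fintype.not_linearIndependent_iff.1 hdep
  obtain ⟨m, -, hm⟩ := Finset.exists_max_image Finset.univ (fun i => |g i|) ⟨i0, Finset.mem_univ _⟩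
  have hm0 : 0 < |g m| := (abs_pos.2 hi0).trans_le (hm i0 (Finset.mem_univ _))
  let a : ι → ℝ := fun i => if h : i ∈ s then g ⟨i, h⟩ / |g m| else 0
  have hale : ∀ i ∈ s, |a i| ≤ 1 := by
    intro i hi
    simp only [a, dif_pos hi, abs_div, abs_abs]
    exact (div_le_one hm0).2 (hm _ (Finset.mem_univ _))
  have hrel : ∑ i ∈ s, a i • w i = 0 := by
    have h1 : ∑ i : s, g i • w i = 0 := by
      simpa [u] using congrArg (W.subtype) hg
    rw [← Finset.sum_attach, ← Finset.univ_eq_attach]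
    have : ∀ i : s, a i • w i = |g m|⁻¹ • (g i • w i) := by
      intro i
      simp only [a, dif_pos i.2, smul_smul]
      congr 1
      rw [div_eq_inv_mul]
    rw [Finset.sum_congr rfl fun i _ => this i, ← Finset.smul_sum, h1, smul_zero]
  refine ⟨a, ⟨m, m.2, ?_⟩, fun i hi => by simp [a, hi], ?_⟩
  · simp only [a, dif_pos m.2, abs_div, abs_abs]
    exact div_self hm0.ne'
  · calc ‖∑ i ∈ s, a i • v i‖ = ‖∑ i ∈ s, a i • (v i - w i)‖ := by
          simp only [smul_sub, Finset.sum_sub_distrib, hrel, sub_zero]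
      _ ≤ ∑ i ∈ s, e := by
          refine norm_sum_le_of_le _ fun i hi => ?_
          rw [norm_smul, Real.norm_eq_abs]
          calc |a i| * ‖v i - w i‖ ≤ 1 * ‖v i - w i‖ := by gcongr; exact hale i hi
            _ ≤ e := by rw [one_mul]; exact hw i hi
      _ = s.card * e := by rw [Finset.sum_const, nsmul_eq_mul]

/-- Move a point of the cube in a given direction until a coordinate of `s` reaches `0` or `1`. -/
theorem exists_move_to_face {ι : Type*} {s : Finset ι} {c a : ι → ℝ}
    (hc : ∀ i ∈ s, c i ∈ Set.Ioo (0 : ℝ) 1) (ha : ∃ i ∈ s, |a i| = 1) :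
    ∃ t ∈ Set.Icc (0 : ℝ) 1, (∀ i ∈ s, c i + t * a i ∈ Set.Icc (0 : ℝ) 1) ∧
      ∃ i ∈ s, c i + t * a i ∉ Set.Ioo (0 : ℝ) 1 := by
  classical
  obtain ⟨i0, hi0, ha0⟩ := ha
  -- `f i` is the time at which coordinate `i` leaves the cube. The first exit time is at most `1`
  -- because some `|a i| = 1`.
  let f : ι → ℝ := fun i => if 0 < a i then (1 - c i) / a i else c i / (-a i)
  have hne : i0 ∈ s.filter (fun i => a i ≠ 0) := by
    refine Finset.mem_filter.2 ⟨hi0, fun h => ?_⟩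
    rw [h] at ha0
    norm_num at ha0
  obtain ⟨m, hm, hmin⟩ := Finset.exists_min_image _ f ⟨i0, hne⟩
  obtain ⟨hms, hma⟩ := Finset.mem_filter.1 hm
  have hf0 : 0 ≤ f m := by
    have := hc m hms
    simp only [f]
    split_ifs with h
    · exact div_nonneg (by linarith [this.2]) h.le
    · exact div_nonneg this.1.le (by linarith)
  have hf1 : f i0 ≤ 1 := by
    have := hc i0 hi0
    simp only [f]
    split_ifs with h
    · rw [abs_of_pos h] at ha0
      rw [ha0]; linarith [this.1]
    · rw [abs_of_nonpos (not_lt.1 h)] at ha0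
      rw [ha0]; linarith [this.2]
  refine ⟨f m, ⟨hf0, (hmin i0 hne).trans hf1⟩, fun i hi => ?_, m, hms, ?_⟩
  · have hci := hc i hi
    rcases lt_trichotomy (a i) 0 with h | h | h
    · have hle := hmin i (Finset.mem_filter.2 ⟨hi, h.ne⟩)
      have hfi : f i = c i / (-a i) := by simp only [f]; rw [if_neg (not_lt.2 h.le)]
      rw [hfi, le_div_iff₀ (by linarith)] at hle
      have := mul_nonneg hf0 (neg_nonneg.2 h.le)
      constructor <;> nlinarith [hci.1, hci.2]
    · rw [h, mul_zero, add_zero]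
      exact ⟨hci.1.le, hci.2.le⟩
    · have hle := hmin i (Finset.mem_filter.2 ⟨hi, h.ne'⟩)
      have hfi : f i = (1 - c i) / a i := by simp only [f]; rw [if_pos h]
      rw [hfi, le_div_iff₀ h] at hle
      have := mul_nonneg hf0 h.le
      constructor <;> nlinarith [hci.1, hci.2]
  · simp only [f]
    split_ifs with h
    · rw [div_mul_cancel₀ _ hma]
      simp
    · have : c m / -a m * a m = -c m := by field_simp
      rw [this]
      simp

/-- The `n`-th term is the cost of removing one of `n` fractional coefficients. With `ρ ^ B = 1 / 2`
it is dominated by `n * ρ ^ n`, the integer division costing a factor `4`. -/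
theorem summable_mul_half_pow_div (B : ℕ) (C : ℝ) (hB : 0 < B) :
    Summable fun n : ℕ => (n : ℝ) * (C * (1 / 2) ^ ((n - 1) / B)) := by
  obtain ⟨ρ, hρ0, hρB⟩ : ∃ ρ : ℝ, 0 ≤ ρ ∧ ρ ^ B = 1 / 2 :=
    ⟨(1 / 2 : ℝ) ^ (B : ℝ)⁻¹, Real.rpow_nonneg (by norm_num) _,
      Real.rpow_inv_natCast_pow (by norm_num) hB.ne'⟩
  have hρ1 : ρ < 1 := by
    by_contra! hge
    have := one_le_pow₀ hge (n := B)
    rw [hρB] at this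
    norm_num at this
  have hnorm : ‖ρ‖ < 1 := by rwa [Real.norm_of_nonneg hρ0]
  have hs := (summable_pow_mul_geometric_of_norm_lt_one 1 hnorm).mul_left (|C| * 4)
  refine Summable.of_norm_bounded hs fun n => ?_
  have key : ((1 : ℝ) / 2) ^ ((n - 1) / B) ≤ 4 * ρ ^ n := by
    have h1 : n ≤ B * ((n - 1) / B + 2) := by
      have := Nat.lt_div_mul_add hB (a := n - 1)
      rw [mul_add, mul_comm B]
      omega
    have h2 := pow_le_pow_of_le_one hρ0 hρ1.le h1
    rw [pow_mul, hρB, pow_add] at h2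
    linarith
  rw [norm_mul, norm_mul, Real.norm_natCast, Real.norm_eq_abs C,
    Real.norm_of_nonneg (pow_nonneg (by norm_num) _)]
  calc (n : ℝ) * (|C| * (1 / 2) ^ ((n - 1) / B)) ≤ n * (|C| * (4 * ρ ^ n)) := by gcongr
    _ = _ := by ring

/-- Coefficients in `[0, 1]` can be replaced by ones of which only boundedly many are fractional. -/
theorem HasExpWidth.exists_few_fractional {T : Set X} {B : ℕ} {C : ℝ} (h : HasExpWidth T B C)
    (hB : 0 < B) {η : ℝ} (hη : 0 < η) : ∃ d : ℕ, ∀ (ι : Type) [Fintype ι] (v : ι → X) (c : ι → ℝ),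
      (∀ i, v i ∈ T) → (∀ i, c i ∈ Set.Icc (0 : ℝ) 1) →
      ∃ c' : ι → ℝ, (∀ i, c' i ∈ Set.Icc (0 : ℝ) 1) ∧
        Nat.card {i // c' i ∈ Set.Ioo (0 : ℝ) 1} ≤ d ∧ ‖∑ i, (c i - c' i) • v i‖ ≤ η := by
  classical
  rcases T.eq_empty_or_nonempty with rfl | ⟨x0, hx0⟩
  · refine ⟨0, fun ι _ v c hv hc => ⟨c, hc, ?_, ?_⟩⟩
    · have : IsEmpty ι := ⟨fun i => hv i⟩
      simp
    · have : IsEmpty ι := ⟨fun i => hv i⟩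
      simpa using hη.le
  have hC : 0 ≤ C := (norm_nonneg _).trans (h.norm_le hx0)
  set τ : ℕ → ℝ := fun n => (n : ℝ) * (C * (1 / 2) ^ ((n - 1) / B)) with hτ
  have hτ0 : ∀ n, 0 ≤ τ n := fun n => by positivity
  have hsum : Summable τ := summable_mul_half_pow_div B C hB
  -- Removing fractional coefficients one at a time until `d` are left costs at most this tail.
  obtain ⟨d, hd⟩ : ∃ d, ∑' k, τ (k + (d + 1)) < η := by
    have := (tendsto_sum_nat_add τ).comp (Filter.tendsto_add_atTop_nat 1)
    exact ((this.eventually_lt_const hη).exists)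
  refine ⟨d, fun ι _ v c hv hc => ?_⟩
  have main : ∀ r : ℕ, ∀ c : ι → ℝ, (∀ i, c i ∈ Set.Icc (0 : ℝ) 1) →
      (Finset.univ.filter fun i => c i ∈ Set.Ioo (0 : ℝ) 1).card ≤ d + r →
      ∃ c' : ι → ℝ, (∀ i, c' i ∈ Set.Icc (0 : ℝ) 1) ∧
        (Finset.univ.filter fun i => c' i ∈ Set.Ioo (0 : ℝ) 1).card ≤ d ∧
        ‖∑ i, (c i - c' i) • v i‖ ≤ ∑ k ∈ Finset.range r, τ (k + (d + 1)) := by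
    intro r
    induction r with
    | zero =>
      intro c hc hcard
      exact ⟨c, hc, by simpa using hcard, by simp⟩
    | succ r ih =>
      intro c hc hcard
      set s := Finset.univ.filter fun i => c i ∈ Set.Ioo (0 : ℝ) 1 with hs
      by_cases hsr : s.card ≤ d + r
      · obtain ⟨c', h1, h2, h3⟩ := ih c hc hsr
        refine ⟨c', h1, h2, h3.trans ?_⟩
        rw [Finset.sum_range_succ]
        linarith [hτ0 (r + (d + 1))]
      have hsc : s.card = r + (d + 1) := by omega
      -- The largest `q` with `B * q < s.card`, so that the vectors outnumber the dimension and an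
      -- almost-relation exists.
      obtain ⟨W, hW, hrk, hap⟩ := h ((s.card - 1) / B)
      obtain ⟨a, ha1, ha0, hav⟩ := exists_almost_relation (v := v) (s := s) (W := W)
        (e := C * (1 / 2) ^ ((s.card - 1) / B))
        (by have := Nat.mul_div_le (s.card - 1) B; omega) (fun i _ => hap _ (hv i))
      have hcs : ∀ i ∈ s, c i ∈ Set.Ioo (0 : ℝ) 1 := fun i hi => (Finset.mem_filter.1 hi).2
      obtain ⟨t, ht, hin, m, hms, hm⟩ := exists_move_to_face hcs ha1
      let c1 : ι → ℝ := fun i => c i + t * a i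
      have hoff : ∀ i ∉ s, c1 i = c i := fun i hi => by simp [c1, ha0 i hi]
      obtain ⟨c', h1, h2, h3⟩ := ih c1 (fun i => by
        by_cases hi : i ∈ s
        · exact hin i hi
        · rw [hoff i hi]; exact hc i) (by
        have : (Finset.univ.filter fun i => c1 i ∈ Set.Ioo (0 : ℝ) 1) ⊆ s.erase m := by
          intro i hi
          have hi' := (Finset.mem_filter.1 hi).2
          have his : i ∈ s := by
            by_contra hcon
            rw [hoff i hcon] at hi'
            exact hcon (Finset.mem_filter.2 ⟨Finset.mem_univ _, hi'⟩)
          exact Finset.mem_erase.2 ⟨fun hh => hm (hh ▸ hi'), his⟩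
        have := Finset.card_le_card this
        rw [Finset.card_erase_of_mem hms] at this
        omega)
      refine ⟨c', h1, h2, ?_⟩
      have hsplit : ∑ i, (c i - c' i) • v i = ∑ i, (c1 i - c' i) • v i
          - t • ∑ i ∈ s, a i • v i := by
        have : ∑ i ∈ s, a i • v i = ∑ i, a i • v i :=
          Finset.sum_subset (Finset.subset_univ _) fun i _ hi => by rw [ha0 i hi, zero_smul]
        rw [this, Finset.smul_sum, ← Finset.sum_sub_distrib]
        refine Finset.sum_congr rfl fun i _ => ?_
        rw [smul_smul, ← sub_smul]
        congr 1
        simp only [c1]; ring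
      rw [hsplit, Finset.sum_range_succ]
      refine (norm_sub_le _ _).trans (add_le_add h3 ?_)
      rw [norm_smul, Real.norm_of_nonneg ht.1]
      calc t * ‖∑ i ∈ s, a i • v i‖ ≤ 1 * ‖∑ i ∈ s, a i • v i‖ := by gcongr; exact ht.2
        _ ≤ τ (r + (d + 1)) := by
          rw [one_mul, hτ, ← hsc]; exact hav
  obtain ⟨c', h1, h2, h3⟩ := main (Fintype.card ι) c hc
    (((Finset.card_filter_le _ _).trans_eq (Finset.card_univ)).trans (Nat.le_add_left _ _))
  refine ⟨c', h1, ?_, h3.trans (le_trans ?_ hd.le)⟩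
  · rw [Nat.card_eq_fintype_card, Fintype.card_subtype]
    exact h2
  · exact ((summable_nat_add_iff (d + 1)).2 hsum).sum_le_tsum _ fun k _ => hτ0 _

/-- Linear combinations of sufficiently short vectors can be rounded to subset sums. -/
theorem HasExpWidth.exists_rounding {T : Set X} {B : ℕ} {C : ℝ} (h : HasExpWidth T B C)
    (hB : 0 < B) {η : ℝ} (hη : 0 < η) : ∃ δ > 0, ∀ (ι : Type) [Fintype ι] (v : ι → X) (c : ι → ℝ),
      (∀ i, v i ∈ T) → (∀ i, ‖v i‖ ≤ δ) → (∀ i, c i ∈ Set.Icc (0 : ℝ) 1) →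
      ∃ A : Set ι, ‖∑ i, (c i - A.indicator 1 i) • v i‖ ≤ η := by
  classical
  obtain ⟨d, hd⟩ := h.exists_few_fractional hB (half_pos hη)
  refine ⟨η / 2 / (d + 1), by positivity, fun ι _ v c hv hvδ hc => ?_⟩
  obtain ⟨c', h1, h2, h3⟩ := hd ι v c hv hc
  -- The at most `d` surviving fractional coefficients are rounded down to `0`; each costs at most
  -- the norm bound `η / 2 / (d + 1)`.
  refine ⟨{i | c' i = 1}, ?_⟩
  have hsplit : ∑ i, (c i - Set.indicator {i | c' i = 1} 1 i) • v i =
      ∑ i, (c i - c' i) • v i + ∑ i, (c' i - Set.indicator {i | c' i = 1} 1 i) • v i := by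
    rw [← Finset.sum_add_distrib]
    refine Finset.sum_congr rfl fun i _ => ?_
    rw [← add_smul]; congr 1; ring
  have hsec : ‖∑ i, (c' i - Set.indicator {i | c' i = 1} 1 i) • v i‖ ≤ η / 2 := by
    have hz : ∀ i, i ∉ (Finset.univ.filter fun i => c' i ∈ Set.Ioo (0 : ℝ) 1) →
        (c' i - Set.indicator {i | c' i = 1} 1 i) • v i = 0 := by
      intro i hi
      have : c' i ∉ Set.Ioo (0 : ℝ) 1 := fun hh => hi (Finset.mem_filter.2 ⟨Finset.mem_univ _, hh⟩)
      have h01 : c' i = 0 ∨ c' i = 1 := by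
        by_contra! hcon
        exact this ⟨lt_of_le_of_ne (h1 i).1 (Ne.symm hcon.1), lt_of_le_of_ne (h1 i).2 hcon.2⟩
      rcases h01 with h0 | h0 <;> simp [h0]
    rw [← Finset.sum_subset (Finset.subset_univ _) fun i _ hi => hz i hi]
    calc _ ≤ ∑ i ∈ (Finset.univ.filter fun i => c' i ∈ Set.Ioo (0 : ℝ) 1), η / 2 / (d + 1) := by
          refine norm_sum_le_of_le _ fun i hi => ?_
          have hi' := (Finset.mem_filter.1 hi).2
          have : i ∉ {i | c' i = 1} := fun hh => (hi'.2.ne hh)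
          rw [Set.indicator_of_notMem this, sub_zero, norm_smul, Real.norm_of_nonneg hi'.1.le]
          calc c' i * ‖v i‖ ≤ 1 * ‖v i‖ := by gcongr; exact hi'.2.le
            _ ≤ _ := by rw [one_mul]; exact hvδ i
      _ ≤ d * (η / 2 / (d + 1)) := by
          rw [Finset.sum_const, nsmul_eq_mul]
          gcongr
          rw [Nat.card_eq_fintype_card, Fintype.card_subtype] at h2
          exact h2
      _ ≤ η / 2 := by
          rw [mul_div_assoc', div_le_iff₀ (by positivity)]
          nlinarith
  rw [hsplit]
  calc _ ≤ η / 2 + η / 2 := norm_add_le_of_le h3 hsec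
    _ = η := by ring

end Rounding

/-! ### Approximation by the semigroup, by transport along chains -/

/-- The chain is prolonged to an infinite sequence, eventually constant at `b`, so that finitely
many chains can be cut at one common length. -/
theorem IsChainConnected.exists_chain {X : Type*} [PseudoMetricSpace X] {A : Set X} {δ : ℝ}
    (h : IsChainConnected A δ) (hδ : 0 < δ) {a b : X} (ha : a ∈ A) (hb : b ∈ A) :
    ∃ p : ℕ → X, p 0 = a ∧ (∀ j, p j ∈ A) ∧ (∀ j, dist (p j) (p (j + 1)) < δ) ∧
      ∀ᶠ j in Filter.atTop, p j = b := by
  have hab := h a ha b hb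
  clear h
  induction hab using Relation.ReflTransGen.head_induction_on with
  | refl => exact ⟨fun _ => b, rfl, fun _ => hb, fun _ => by simpa using hδ, by simp⟩
  | @head x y hxy _ ih =>
    obtain ⟨p, h0, hA, hd, hev⟩ := ih hxy.2.1
    refine ⟨fun j => Nat.casesOn j x p, rfl, fun j => ?_, fun j => ?_, ?_⟩
    · cases j with
      | zero => exact ha
      | succ j => exact hA j
    · cases j with
      | zero => simpa [h0] using hxy.2.2
      | succ j => exact hd j
    · obtain ⟨n, hn⟩ := Filter.eventually_atTop.1 hev
      refine Filter.eventually_atTop.2 ⟨n + 1, fun j hj => ?_⟩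
      cases j with
      | zero => omega
      | succ j => exact hn j (by omega)

/-- A reserve of `d` copies of every `f z` covers any family of at most `d` choices `g i`; the
unused copies `r` remain in `S`. -/
theorem exists_nsmul_sum_eq_add {X ι : Type*} [AddCommMonoid X] [Fintype ι] {S : AddSubmonoid X}
    {Z : Finset X} {f : X → X} (hf : ∀ z ∈ Z, f z ∈ S) {g : ι → X} (hg : ∀ i, g i ∈ Z) {d : ℕ}
    (hd : Fintype.card ι ≤ d) : ∃ r ∈ S, d • ∑ z ∈ Z, f z = ∑ i, f (g i) + r := by
  classical
  refine ⟨∑ z ∈ Z, (d - (Finset.univ.filter fun i => g i = z).card) • f z,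
    S.sum_mem fun z hz => S.nsmul_mem (hf z hz) _, ?_⟩
  have h1 : ∑ i, f (g i) = ∑ z ∈ Z, (Finset.univ.filter fun i => g i = z).card • f z := by
    rw [← Finset.sum_fiberwise_of_maps_to (t := Z) (g := g) fun i _ => hg i]
    refine Finset.sum_congr rfl fun z _ => ?_
    rw [← Finset.sum_const]
    refine Finset.sum_congr rfl fun i hi => ?_
    rw [(Finset.mem_filter.1 hi).2]
  rw [h1, ← Finset.sum_add_distrib, Finset.smul_sum]
  refine Finset.sum_congr rfl fun z _ => ?_
  rw [← add_nsmul]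
  congr 1
  have := (Finset.card_filter_le (Finset.univ : Finset ι) fun i => g i = z)
  rw [Finset.card_univ] at this
  omega

theorem sum_ite_smul_eq_sum_subtype {ι E : Type*} [Fintype ι] [AddCommGroup E] [Module ℝ E]
    (q : ι → Prop) [DecidablePred q] (c : ι → ℝ) (y : ι → E) :
    ∑ i, (if q i then c i else 0) • y i = ∑ i : {i // q i}, c i • y i := by
  rw [← Finset.sum_subtype (Finset.univ.filter q) (by simp) fun i => c i • y i, Finset.sum_filter]
  refine Finset.sum_congr rfl fun i _ => ?_
  split_ifs <;> simp

section Semigroup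

variable {X : Type*} [NormedAddCommGroup X] [NormedSpace ℝ X]

/-- In a chain connected set of small exponential width, fractional multiples of boundedly many
vectors can be redistributed along chains, so that a point which, after subtracting any element of
the semigroup generated by the set, lies in the closed cone generated by the set is close to the
semigroup. -/
theorem HasExpWidth.exists_mem_addSubmonoid_closure {T : Set X} {B : ℕ} {C : ℝ}
    (h : HasExpWidth T B C) (hB : 0 < B) {η : ℝ} (hη : 0 < η) :
    ∃ δ > 0, ∀ T' ⊆ T, T'.Nonempty → TotallyBounded T' → IsChainConnected T' δ → ∀ x : X,
      (∀ w ∈ AddSubmonoid.closure T', ∀ ε > 0, ∃ (ι : Type) (_ : Fintype ι) (v : ι → X) (c : ι → ℝ),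
        (∀ i, v i ∈ T') ∧ (∀ i, 0 ≤ c i) ∧ (∃ N : ℕ, ∑ i, c i = N) ∧
          ‖x - w - ∑ i, c i • v i‖ ≤ ε) →
      ∃ w ∈ AddSubmonoid.closure T', ‖x - w‖ ≤ η := by
  classical
  rcases T.eq_empty_or_nonempty with rfl | ⟨t0, ht0⟩
  · exact ⟨1, one_pos, fun T' hT' hne => absurd (hT' hne.some_mem) (Set.notMem_empty _)⟩
  have hC : 0 ≤ C := (norm_nonneg _).trans (h.norm_le ht0)
  -- The final error has three parts of size `e` (cone approximation, first rounding, rounding along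
  -- chains) and one of size `e * C` from the mass defect at `b`. The bound `e < 1` is needed for
  -- the integrality argument.
  obtain ⟨e, he0, he1, heη⟩ : ∃ e : ℝ, 0 < e ∧ e < 1 ∧ e * (3 + C) ≤ η := by
    refine ⟨min (1 / 2) (η / (3 + C)), lt_min (by norm_num) (by positivity),
      (min_le_left _ _).trans_lt (by norm_num), ?_⟩
    calc min (1 / 2) (η / (3 + C)) * (3 + C) ≤ η / (3 + C) * (3 + C) := by
          gcongr; exact min_le_right _ _
      _ = η := div_mul_cancel₀ _ (by positivity)
  obtain ⟨d, hd⟩ := h.prodMk_one.exists_few_fractional (Nat.succ_pos B) he0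
  obtain ⟨δ, hδ, hround⟩ := h.sub.exists_rounding hB he0
  refine ⟨δ, hδ, fun T' hT' ⟨b, hb⟩ htb hchain x hcone => ?_⟩
  set S := AddSubmonoid.closure T' with hS
  have hTS : T' ⊆ S := AddSubmonoid.subset_closure
  obtain ⟨Z, hZT, hZfin, hZ⟩ := Metric.finite_approx_of_totallyBounded htb δ hδ
  lift Z to Finset X using hZfin
  choose! p hp0 hpT hpd hpb using fun a (ha : a ∈ T') => hchain.exists_chain hδ ha hb
  obtain ⟨M, hM⟩ : ∃ M, ∀ z ∈ Z, p z M = b :=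
    ((Filter.eventually_all_finset Z).2 fun z hz => hpb z (hZT hz)).exists
  -- `f z` is the sum over the whole chain from `z` to `b`. A reserve of `d` copies is subtracted
  -- from `x` before the cone approximation, ahead of knowing which chains will be used.
  let f : X → X := fun z => ∑ j ∈ Finset.range (M + 1), p z j
  have hfS : ∀ z ∈ Z, f z ∈ S := fun z hz => S.sum_mem fun j _ => hTS (hpT z (hZT hz) j)
  obtain ⟨ι, _, v, c, hvT, hc0, ⟨N, hN⟩, hxw⟩ := hcone (d • ∑ z ∈ Z, f z)
    (S.nsmul_mem (S.sum_mem hfS) d) e he0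
  obtain ⟨c', hc', hcard, hred⟩ := hd ι (fun i => ((1 : ℝ), v i)) (fun i => Int.fract (c i))
    (fun i => ⟨v i, hT' (hvT i), rfl⟩) fun i => ⟨Int.fract_nonneg _, (Int.fract_lt_one _).le⟩
  let Fr := {i : ι // c' i ∈ Set.Ioo (0 : ℝ) 1}
  rw [Nat.card_eq_fintype_card] at hcard
  have hzex : ∀ i : Fr, ∃ z ∈ Z, dist (v i) z < δ := by
    intro i
    have := hZ (hvT i)
    simpa using this
  choose z hzZ hzd using hzex
  -- The path from `v i` through the net point `z i` and along its chain to `b`. Its consecutive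
  -- differences are short and telescope to `v i - b`.
  let P : Fr → ℕ → X := fun i j => Nat.casesOn j (v i) (p (z i))
  have hPT : ∀ i j, P i j ∈ T' := by
    intro i j
    cases j with
    | zero => exact hvT i
    | succ j => exact hpT _ (hZT (hzZ i)) j
  have hPd : ∀ i j, ‖P i j - P i (j + 1)‖ ≤ δ := by
    intro i j
    rw [← dist_eq_norm]
    cases j with
    | zero =>
      have : P i 1 = z i := hp0 _ (hZT (hzZ i))
      rw [zero_add, this]
      exact (hzd i).le
    | succ j => exact (hpd _ (hZT (hzZ i)) j).le
  have hPsum : ∀ i, ∑ j : Fin (M + 1), (P i j - P i (j + 1)) = v i - b := by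
    intro i
    rw [Fin.sum_univ_eq_sum_range (fun j => P i j - P i (j + 1)), Finset.sum_range_sub']
    congr 1
    exact hM _ (hzZ i)
  have hfP : ∀ i, f (z i) = ∑ j : Fin (M + 1), P i (j + 1) := by
    intro i
    rw [Fin.sum_univ_eq_sum_range (fun j => P i (j + 1))]
  -- Moving the weight `c' i` from `v i` to `b` is a combination of short differences, so it can be
  -- rounded to a subset sum.
  obtain ⟨A, hA⟩ := hround (Fr × Fin (M + 1)) (fun q => P q.1 q.2 - P q.1 (q.2 + 1))
    (fun q => c' q.1) (fun q => ⟨_, hT' (hPT q.1 q.2), _, hT' (hPT q.1 (q.2 + 1)), rfl⟩) (fun q => hPd _ _)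
    fun q => hc' _
  obtain ⟨r, hrS, hr⟩ := exists_nsmul_sum_eq_add hfS hzZ hcard
  let m : ι → ℕ := fun i => ⌊c i⌋₊ + if c' i = 1 then 1 else 0
  let l : ι → ℝ := fun i => if c' i ∈ Set.Ioo (0 : ℝ) 1 then c' i else 0
  have hml : ∀ i, c i - Int.fract (c i) + c' i = m i + l i := by
    intro i
    have h1 : c i - Int.fract (c i) = (⌊c i⌋₊ : ℝ) := by
      rw [Int.self_sub_fract, natCast_floor_eq_intCast_floor (hc0 i)]
    have h2 := hc' i
    rw [h1]
    simp only [m, l]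
    by_cases h3 : c' i ∈ Set.Ioo (0 : ℝ) 1
    · rw [if_neg h3.2.ne, if_pos h3]; simp
    · rw [if_neg h3]
      by_cases h4 : c' i = 1
      · simp [h4]
      · have : c' i = 0 := by
          by_contra h5
          exact h3 ⟨lt_of_le_of_ne h2.1 (Ne.symm h5), lt_of_le_of_ne h2.2 h4⟩
        simp [this]
  have hred1 : ‖∑ i, (Int.fract (c i) - c' i) • v i‖ ≤ e := by
    have := (norm_snd_le _).trans hred
    simpa [Prod.snd_sum] using this
  have hred2 : |∑ i, (Int.fract (c i) - c' i)| ≤ e := by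
    have := (norm_fst_le _).trans hred
    simpa [Prod.fst_sum] using this
  have hfr : ∀ i, Int.fract (c i) - c' i = c i - (m i + l i) := fun i => by
    rw [← hml i]; ring
  simp only [hfr] at hred1 hred2
  set s : ℝ := ∑ i : Fr, c' i with hs
  have hs0 : 0 ≤ s := Finset.sum_nonneg fun i _ => (hc' i).1
  have hls : ∑ i, l i = s := by
    have := sum_ite_smul_eq_sum_subtype (fun i => c' i ∈ Set.Ioo (0 : ℝ) 1) c' fun _ => (1 : ℝ)
    simp only [smul_eq_mul, mul_one] at this
    exact this
  have hmass : |(N : ℝ) - (∑ i, m i : ℕ) - s| ≤ e := by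
    rw [Finset.sum_sub_distrib, hN, Finset.sum_add_distrib, hls] at hred2
    push_cast
    rwa [← sub_sub] at hred2
  -- Since the total mass `N` is an integer, the mass `s` moved to `b` lies within `e` of a natural
  -- number `k`; `s ≥ 0` and `e < 1` exclude a negative one.
  obtain ⟨k, hk⟩ : ∃ k : ℕ, N = ∑ i, m i + k := by
    refine Nat.exists_eq_add_of_le ?_
    by_contra! hlt
    have h1 : (N : ℝ) + 1 ≤ (∑ i, m i : ℕ) := by exact_mod_cast hlt
    have := (abs_le.1 hmass).1
    linarith
  have hks : |(s - k)| ≤ e := by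
    rw [abs_sub_comm]
    have : (k : ℝ) - s = (N : ℝ) - (∑ i, m i : ℕ) - s := by
      rw [hk, Nat.cast_add]; ring
    rwa [this]
  -- The selected differences may be negative, but added to the reserved `P i (j + 1)` each gives
  -- either `P i j` or `P i (j + 1)`, both generators.
  have hrw : ∑ i, f (z i) + ∑ q : Fr × Fin (M + 1),
      A.indicator (1 : Fr × Fin (M + 1) → ℝ) q • (P q.1 q.2 - P q.1 (q.2 + 1)) ∈ S := by
    simp only [hfP]
    rw [← Fintype.sum_prod_type' (f := fun (i : Fr) (j : Fin (M + 1)) => P i (j + 1)),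
      ← Finset.sum_add_distrib]
    refine S.sum_mem fun q _ => ?_
    by_cases hq : q ∈ A
    · simpa [hq] using hTS (hPT q.1 q.2)
    · simpa [hq] using hTS (hPT q.1 (q.2 + 1))
  refine ⟨(∑ i, f (z i) + ∑ q : Fr × Fin (M + 1),
      A.indicator (1 : Fr × Fin (M + 1) → ℝ) q • (P q.1 q.2 - P q.1 (q.2 + 1))) + r
      + ∑ i, m i • v i + k • b, S.add_mem (S.add_mem (S.add_mem hrw hrS)
        (S.sum_mem fun i _ => S.nsmul_mem (hTS (hvT i)) _)) (S.nsmul_mem (hTS hb) _), ?_⟩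
  have htel : ∑ q : Fr × Fin (M + 1), c' q.1 • (P q.1 q.2 - P q.1 (q.2 + 1)) =
      ∑ i, l i • v i - s • b := by
    rw [Fintype.sum_prod_type, sum_ite_smul_eq_sum_subtype (fun i => c' i ∈ Set.Ioo (0 : ℝ) 1), hs, Finset.sum_smul, ← Finset.sum_sub_distrib]
    refine Finset.sum_congr rfl fun i _ => ?_
    change ∑ j : Fin (M + 1), c' i • (P i j - P i (j + 1)) = _
    rw [← Finset.smul_sum, hPsum, smul_sub]
  have hid : x - ((∑ i, f (z i) + ∑ q : Fr × Fin (M + 1),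
      A.indicator (1 : Fr × Fin (M + 1) → ℝ) q • (P q.1 q.2 - P q.1 (q.2 + 1))) + r
      + ∑ i, m i • v i + k • b) = (x - d • ∑ z ∈ Z, f z - ∑ i, c i • v i)
      + ∑ i, (c i - (m i + l i)) • v i
      + ∑ q : Fr × Fin (M + 1), (c' q.1 - A.indicator (1 : Fr × Fin (M + 1) → ℝ) q) •
        (P q.1 q.2 - P q.1 (q.2 + 1)) + (s - k) • b := by
    simp only [sub_smul, add_smul, Finset.sum_sub_distrib, Finset.sum_add_distrib, htel, hr,
      Nat.cast_smul_eq_nsmul]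
    abel
  rw [hid]
  have hbn : ‖(s - k) • b‖ ≤ e * C := by
    rw [norm_smul, Real.norm_eq_abs]
    gcongr
    exact h.norm_le (hT' hb)
  calc _ ≤ e + e + e + e * C :=
        norm_add_le_of_le (norm_add_le_of_le (norm_add_le_of_le hxw hred1) hA) hbn
    _ = e * (3 + C) := by ring
    _ ≤ η := heη

end Semigroup

/-! ### Duality: nonnegative combinations of integer total mass -/

/-- If every functional that is nonnegative on `T` annihilates `T` and `x`, then translates of `x`
by elements of the semigroup generated by `T` are limits of nonnegative combinations of elements
of `T` with integer total mass. -/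
theorem exists_integer_mass_combination {X : Type*} [NormedAddCommGroup X] [NormedSpace ℝ X]
    {T : Set X} (hne : T.Nonempty) {x : X}
    (hT : ∀ l : X →L[ℝ] ℝ, (∀ t ∈ T, 0 ≤ l t) → (∀ t ∈ T, l t = 0) ∧ l x = 0) {w : X}
    (hw : w ∈ AddSubmonoid.closure T) {ε : ℝ} (hε : 0 < ε) :
    ∃ (ι : Type) (_ : Fintype ι) (v : ι → X) (c : ι → ℝ),
      (∀ i, v i ∈ T) ∧ (∀ i, 0 ≤ c i) ∧ (∃ N : ℕ, ∑ i, c i = N) ∧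
        ‖x - w - ∑ i, c i • v i‖ ≤ ε := by
  let Q : PointedCone ℝ X := Submodule.span _ T
  -- Hahn–Banach separation from the closed cone generated by `T`.
  have key : ∀ y : X, (∀ l : X →L[ℝ] ℝ, (∀ t ∈ T, 0 ≤ l t) → l y = 0) → y ∈ closure (Q : Set X) := by
    intro y hy
    by_contra hcon
    obtain ⟨f, u, hfu, huy⟩ := geometric_hahn_banach_closed_point Q.convex.closure isClosed_closure hcon
    have h0 : 0 < u := by
      have := hfu 0 (subset_closure Q.zero_mem)
      rwa [map_zero] at this
    have hle : ∀ t ∈ T, f t ≤ 0 := by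
      intro t ht
      by_contra! hpos
      have h1 := hfu ((u / f t) • t) (subset_closure
        (Q.smul_mem (by positivity : 0 ≤ u / f t) (Submodule.subset_span ht)))
      rw [map_smul, smul_eq_mul, div_mul_cancel₀ _ hpos.ne'] at h1
      exact lt_irrefl _ h1
    have := hy (-f) fun t ht => by simpa using hle t ht
    simp only [neg_apply, neg_eq_zero] at this
    linarith
  have rep : ∀ y : X, (∀ l : X →L[ℝ] ℝ, (∀ t ∈ T, 0 ≤ l t) → l y = 0) → ∀ e > 0,
      ∃ (n : ℕ) (v : Fin n → X) (c : Fin n → ℝ),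
        (∀ i, v i ∈ T) ∧ (∀ i, 0 ≤ c i) ∧ ‖y - ∑ i, c i • v i‖ < e := by
    intro y hy e he
    obtain ⟨z, hz, hyz⟩ := Metric.mem_closure_iff.1 (key y hy) e he
    obtain ⟨n, c, v, hcv⟩ := Submodule.mem_span_set'.1 hz
    refine ⟨n, fun i => v i, fun i => c i, fun i => (v i).2, fun i => (c i).2, ?_⟩
    rw [← dist_eq_norm]
    convert hyz using 2
    exact hcv
  have hw0 : ∀ l : X →L[ℝ] ℝ, (∀ t ∈ T, 0 ≤ l t) → l w = 0 := by
    intro l hl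
    induction hw using AddSubmonoid.closure_induction with
    | mem t ht => exact (hT l hl).1 t ht
    | zero => exact map_zero _
    | add a b _ _ ha hb => rw [map_add, ha, hb, add_zero]
  obtain ⟨t, ht⟩ := hne
  obtain ⟨n, v, c, hv, hc, hvc⟩ := rep (x - w)
    (fun l hl => by rw [map_sub, (hT l hl).2, hw0 l hl, sub_zero]) (ε / 2) (half_pos hε)
  -- Approximating `-t` makes `t + ∑ c' i • v' i` a nearly zero combination of mass `1 + m`. Adding
  -- `s ≤ 1` times it raises the total mass from `M` to `⌈M⌉₊` at little cost.
  obtain ⟨n', v', c', hv', hc', hvc'⟩ := rep (-t)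
    (fun l hl => by rw [map_neg, (hT l hl).1 t ht, neg_zero]) (ε / 2) (half_pos hε)
  set m := ∑ i, c' i with hm
  have hm0 : 0 ≤ m := Finset.sum_nonneg fun i _ => hc' i
  set M := ∑ i, c i with hM
  have hM0 : 0 ≤ M := Finset.sum_nonneg fun i _ => hc i
  set s : ℝ := (⌈M⌉₊ - M) / (1 + m) with hs
  have hs0 : 0 ≤ s := div_nonneg (sub_nonneg.2 (Nat.le_ceil M)) (by positivity)
  have hs1 : s ≤ 1 := by
    rw [hs, div_le_one (by positivity)]
    linarith [Nat.ceil_lt_add_one hM0]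
  refine ⟨Fin n ⊕ Option (Fin n'), inferInstance, Sum.elim v fun o => o.elim t v',
    Sum.elim c fun o => s * o.elim 1 c', ?_, ?_, ⟨⌈M⌉₊, ?_⟩, ?_⟩
  · rintro (i | _ | i)
    exacts [hv i, ht, hv' i]
  · rintro (i | _ | i)
    exacts [hc i, by simpa using hs0, mul_nonneg hs0 (hc' i)]
  · simp only [Fintype.sum_sum_type, Sum.elim_inl, Sum.elim_inr, Fintype.sum_option, Option.elim_none,
      Option.elim_some]
    rw [← Finset.mul_sum, ← hm, ← hM, ← mul_add, hs, div_mul_cancel₀ _ (by positivity)]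
    ring
  · simp only [Fintype.sum_sum_type, Sum.elim_inl, Sum.elim_inr, Fintype.sum_option, Option.elim_none,
      Option.elim_some, mul_smul, ← Finset.smul_sum]
    have : x - w - (∑ i, c i • v i + (s • t + s • ∑ i, c' i • v' i)) =
        (x - w - ∑ i, c i • v i) + s • (-t - ∑ i, c' i • v' i) := by
      rw [smul_sub, smul_neg]; abel
    rw [one_smul, smul_add, this]
    have h2 : ‖s • (-t - ∑ i, c' i • v' i)‖ ≤ ε / 2 := by
      rw [norm_smul, Real.norm_of_nonneg hs0]
      calc s * _ ≤ 1 * ‖-t - ∑ i, c' i • v' i‖ := by gcongr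
        _ ≤ ε / 2 := by rw [one_mul]; exact hvc'.le
    linarith [norm_add_le_of_le hvc.le h2]

/-! ### Extremum principles near infinity -/

/-- A function holomorphic near infinity, vanishing at infinity, with nonnegative real part, is
zero near infinity. -/
theorem eventually_cobounded_eq_zero_of_re_nonneg {q : ℂ → ℂ}
    (hd : ∀ᶠ ζ in Bornology.cobounded ℂ, DifferentiableAt ℂ q ζ)
    (ht : Filter.Tendsto q (Bornology.cobounded ℂ) (nhds 0))
    (hre : ∀ᶠ ζ in Bornology.cobounded ℂ, 0 ≤ (q ζ).re) :
    ∀ᶠ ζ in Bornology.cobounded ℂ, q ζ = 0 := by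
  have hinv : Filter.Tendsto (fun w : ℂ => w⁻¹) (nhdsWithin 0 {0}ᶜ) (Bornology.cobounded ℂ) :=
    Filter.tendsto_inv₀_nhdsNE_zero
  let h : ℂ → ℂ := Function.update (fun w => q w⁻¹) 0 0
  have hne : ∀ w, w ≠ 0 → h w = q w⁻¹ := fun w hw => Function.update_of_ne hw _ _
  have h0 : h 0 = 0 := Function.update_self _ _ _
  have hcont : ContinuousAt h 0 := continuousAt_update_same.2 (ht.comp hinv)
  have hpd : ∀ᶠ w in nhdsWithin (0 : ℂ) {0}ᶜ, DifferentiableAt ℂ h w := by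
    filter_upwards [hinv.eventually hd, self_mem_nhdsWithin] with w hw hw0
    have hdiff : DifferentiableAt ℂ (fun w => q w⁻¹) w := hw.fun_comp' w (differentiableAt_inv hw0)
    refine hdiff.congr_of_eventuallyEq ?_
    filter_upwards [isOpen_ne.mem_nhds hw0] with y hy using hne y hy
  have han : AnalyticAt ℂ h 0 :=
    Complex.analyticAt_of_differentiable_on_punctured_nhds_of_continuousAt hpd hcont
  -- In the coordinate `w = 1 / ζ`, `‖exp (-h)‖ ≤ 1` with equality at `0`, so the maximum principle
  -- makes `exp (-h)` locally constant.
  let G : ℂ → ℂ := fun w => Complex.exp (-h w)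
  have hGd : ∀ᶠ w in nhds (0 : ℂ), DifferentiableAt ℂ G w := by
    filter_upwards [han.eventually_analyticAt] with w hw
    exact hw.differentiableAt.neg.cexp
  have hmax : IsLocalMax (norm ∘ G) 0 := by
    have : ∀ᶠ w in nhds (0 : ℂ), w ≠ 0 → 0 ≤ (q w⁻¹).re :=
      eventually_nhdsWithin_iff.1 (hinv.eventually hre)
    filter_upwards [this] with w hw
    simp only [Function.comp, G, h0, Complex.norm_exp]
    by_cases hw0 : w = 0
    · simp [hw0, h0]
    · rw [hne w hw0]
      simpa using hw hw0
  have hconst := Complex.eventually_eq_of_isLocalMax_norm hGd hmax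
  -- Smallness of `h` selects the value `0` among the solutions `2πiℤ` of `exp (-h) = 1`.
  have hsmall : ∀ᶠ w in nhds (0 : ℂ), ‖h w‖ < Real.pi := by
    have := hcont.norm
    rw [ContinuousAt, h0, norm_zero] at this
    exact this.eventually_lt_const Real.pi_pos
  have hzero : ∀ᶠ w in nhds (0 : ℂ), h w = 0 := by
    filter_upwards [hconst, hsmall] with w hw hw'
    have h1 : Complex.exp (-h w) = 1 := by simpa [G, h0] using hw
    have him := (Complex.abs_im_le_norm (-h w)).trans_lt (by rwa [norm_neg])
    have h2 := Complex.log_exp (abs_lt.1 him).1 (abs_lt.1 him).2.le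
    rw [h1, Complex.log_one] at h2
    exact neg_eq_zero.1 h2.symm
  have hinv' : Filter.Tendsto (fun w : ℂ => w⁻¹) (Bornology.cobounded ℂ) (nhds 0) :=
    Filter.tendsto_inv₀_cobounded
  filter_upwards [hinv'.eventually hzero, Bornology.eventually_ne_cobounded (0 : ℂ)] with ζ hζ hζ0
  rwa [hne _ (inv_ne_zero hζ0), inv_inv] at hζ

/-- Minimum principle for the real part on the exterior of a bounded open set. -/
theorem eventually_cobounded_re_nonneg {q : ℂ → ℂ} {U A : Set ℂ} (hUo : IsOpen U)
    (hUb : Bornology.IsBounded U) (hUA : frontier U ⊆ A)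
    (hd : ∀ ζ ∉ U, DifferentiableAt ℂ q ζ)
    (ht : Filter.Tendsto q (Bornology.cobounded ℂ) (nhds 0)) (hA : ∀ ζ ∈ A, 0 ≤ (q ζ).re) :
    ∀ᶠ ζ in Bornology.cobounded ℂ, 0 ≤ (q ζ).re := by
  have hcl : ∀ᶠ ζ in Bornology.cobounded ℂ, ζ ∈ (closure U)ᶜ :=
    Bornology.isBounded_def.1 hUb.closure
  filter_upwards [hcl] with ζ hζ
  refine le_of_forall_pos_lt_add fun ε hε => ?_
  have hsmall : ∀ᶠ w in Bornology.cobounded ℂ, ‖q w‖ < ε / 2 := by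
    have := ht.norm
    rw [norm_zero] at this
    exact this.eventually_lt_const (half_pos hε)
  obtain ⟨R, -, hR⟩ := (Metric.hasBasis_cobounded_compl_closedBall (0 : ℂ)).eventually_iff.1 hsmall
  set R' := max R ‖ζ‖ + 1 with hR'
  have hRR : R < R' := (le_max_left _ _).trans_lt (lt_add_one _)
  have hζR : ‖ζ‖ < R' := (le_max_right _ _).trans_lt (lt_add_one _)
  -- The maximum principle is applied to `exp (-q)` on the exterior cut off by a circle where `‖q‖ <
  -- ε / 2`.
  set V : Set ℂ := (closure U)ᶜ ∩ Metric.ball 0 R' with hV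
  have hVU : closure V ⊆ Uᶜ :=
    closure_minimal (fun z hz h => hz.1 (subset_closure h)) hUo.isClosed_compl
  have hdc : DiffContOnCl ℂ (fun z => Complex.exp (-q z)) V :=
    DifferentiableOn.diffContOnCl fun z hz =>
      (hd z (hVU hz)).neg.cexp.differentiableWithinAt
  have hbd : ∀ z ∈ frontier V, ‖Complex.exp (-q z)‖ ≤ Real.exp (ε / 2) := by
    intro z hz
    rw [Complex.norm_exp, Real.exp_le_exp, Complex.neg_re]
    rcases frontier_inter_subset _ _ hz with h | h
    · rw [frontier_compl] at h
      have := hA z (hUA (frontier_closure_subset h.1))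
      linarith
    · rw [frontier_ball _ (by linarith [norm_nonneg ζ])] at h
      have hzR : z ∈ (Metric.closedBall (0 : ℂ) R)ᶜ := by
        have h1 := mem_sphere_zero_iff_norm.1 h.2
        rw [Set.mem_compl_iff, mem_closedBall_zero_iff, h1]
        exact not_le.2 hRR
      have := hR hzR
      have h2 := Complex.abs_re_le_norm (q z)
      have h3 := neg_abs_le (q z).re
      linarith
  have hle := Complex.norm_le_of_forall_mem_frontier_norm_le
    (Metric.isBounded_ball.subset Set.inter_subset_right) hdc hbd
    (subset_closure (show ζ ∈ V from ⟨hζ, mem_ball_zero_iff.2 hζR⟩))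
  rw [Complex.norm_exp, Real.exp_le_exp, Complex.neg_re] at hle
  linarith

/-! ### Cauchy kernels as resolvents in `C(K, ℂ)` -/

section CauchyKernel

variable {K : Set ℂ}

/-- The coordinate function on `K`. -/
def coordFun (K : Set ℂ) : C(K, ℂ) := ⟨Subtype.val, continuous_subtype_val⟩

/-- The function `z ↦ 1 / (ζ - z)` on `K`. -/
noncomputable def cauchyKernel (K : Set ℂ) (ζ : ℂ) : C(K, ℂ) := resolvent (coordFun K) ζ

theorem mem_resolventSet_coordFun {ζ : ℂ} (hζ : ζ ∉ K) : ζ ∈ resolventSet ℂ (coordFun K) := by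
  rw [spectrum.mem_resolventSet_iff, ContinuousMap.isUnit_iff_forall_ne_zero]
  rintro ⟨z, hz⟩ h
  have : ζ - z = 0 := h
  exact hζ (by rwa [sub_eq_zero.1 this])

theorem cauchyKernel_apply {ζ : ℂ} (hζ : ζ ∉ K) (z : K) : cauchyKernel K ζ z = 1 / (ζ - z) := by
  have h1 := Ring.mul_inverse_cancel _ (mem_resolventSet_coordFun hζ)
  have h2 : (ζ - z) * cauchyKernel K ζ z = 1 := congr($h1 z)
  have h3 : ζ - z ≠ 0 := fun h => by simp [h] at h2
  rw [eq_div_iff h3, mul_comm, h2]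

theorem differentiableAt_cauchyKernel [CompactSpace K] {ζ : ℂ} (hζ : ζ ∉ K) :
    DifferentiableAt ℂ (cauchyKernel K) ζ :=
  (spectrum.hasDerivAt_resolvent_const_left (mem_resolventSet_coordFun hζ)).differentiableAt

theorem tendsto_cauchyKernel_cobounded [CompactSpace K] :
    Filter.Tendsto (cauchyKernel K) (Bornology.cobounded ℂ) (nhds 0) :=
  spectrum.resolvent_tendsto_cobounded _

/-- A functional nonnegative on the Cauchy kernels with poles on a set separating `K` from infinity
annihilates all Cauchy kernels with poles off `K`. -/
theorem cauchyKernel_annihilated_of_nonneg [CompactSpace K] (hK : IsPreconnected Kᶜ) {U A : Set ℂ}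
    (hKU : K ⊆ U) (hUo : IsOpen U) (hUb : Bornology.IsBounded U) (hUA : frontier U ⊆ A)
    {l : C(K, ℂ) →L[ℝ] ℝ} {L : C(K, ℂ) →L[ℂ] ℂ} (hlL : ∀ x, (L x).re = l x)
    (hl : ∀ ζ ∈ A, 0 ≤ l (cauchyKernel K ζ)) {ζ : ℂ} (hζ : ζ ∉ K) : L (cauchyKernel K ζ) = 0 := by
  have hKc : IsCompact K := isCompact_iff_compactSpace.2 inferInstance
  let q : ℂ → ℂ := fun ζ => L (cauchyKernel K ζ)
  have hqd : ∀ ζ ∉ K, DifferentiableAt ℂ q ζ := fun ζ hζ =>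
    L.differentiableAt.comp ζ (differentiableAt_cauchyKernel hζ)
  have hqt : Filter.Tendsto q (Bornology.cobounded ℂ) (nhds 0) := by
    have := (L.continuous.tendsto 0).comp (tendsto_cauchyKernel_cobounded (K := K))
    rwa [map_zero] at this
  have hcob : ∀ᶠ ζ in Bornology.cobounded ℂ, ζ ∈ Kᶜ := Bornology.isBounded_def.1 hKc.isBounded
  -- Positivity on `frontier U` spreads to the exterior and forces `q = 0` near infinity;
  -- connectedness of `Kᶜ` then carries the zero to every pole off `K`.
  have hre := eventually_cobounded_re_nonneg hUo hUb hUA (fun ζ hζ => hqd ζ fun h => hζ (hKU h)) hqt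
    fun ζ hζ => (hlL _).symm ▸ hl ζ hζ
  have hz := eventually_cobounded_eq_zero_of_re_nonneg
    (hcob.mono fun ζ hζ => hqd ζ hζ) hqt hre
  obtain ⟨R, -, hR⟩ := (Metric.hasBasis_cobounded_compl_closedBall (0 : ℂ)).eventually_iff.1
    (hz.and hcob)
  have hw : (((|R| + 1 : ℝ) : ℂ)) ∈ (Metric.closedBall (0 : ℂ) R)ᶜ := by
    rw [Set.mem_compl_iff, mem_closedBall_zero_iff, Complex.norm_real,
      Real.norm_of_nonneg (by positivity)]
    linarith [le_abs_self R]
  have han : AnalyticOnNhd ℂ q Kᶜ :=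
    DifferentiableOn.analyticOnNhd (fun ζ hζ => (hqd ζ hζ).differentiableWithinAt)
      hKc.isClosed.isOpen_compl
  refine han.eqOn_zero_of_preconnected_of_eventuallyEq_zero hK (hR hw).2 ?_ hζ
  filter_upwards [Metric.isClosed_closedBall.isOpen_compl.mem_nhds hw] with y hy using (hR hy).1

/-- Iterated resolvent identity: a geometric expansion about the pole `a`, whose exact remainder is
the source of the exponential widths. -/
theorem cauchyKernel_eq_sum_add {a ζ : ℂ} (ha : a ∉ K) (hζ : ζ ∉ K) (q : ℕ) :
    cauchyKernel K ζ = ∑ k ∈ Finset.range q, (a - ζ) ^ k • cauchyKernel K a ^ (k + 1) +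
      (a - ζ) ^ q • (cauchyKernel K a ^ q * cauchyKernel K ζ) := by
  induction q with
  | zero => simp
  | succ q ih =>
    conv_lhs => rw [ih]
    rw [Finset.sum_range_succ, add_assoc]
    congr 1
    ext z
    have h1 : a - z ≠ 0 := fun h => ha (by rw [sub_eq_zero.1 h]; exact z.2)
    have h2 : ζ - z ≠ 0 := fun h => hζ (by rw [sub_eq_zero.1 h]; exact z.2)
    simp only [ContinuousMap.add_apply, ContinuousMap.smul_apply, ContinuousMap.mul_apply,
      ContinuousMap.pow_apply, cauchyKernel_apply ha, cauchyKernel_apply hζ, smul_eq_mul]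
    have key : 1 / (ζ - z) = 1 / (a - z) + (a - ζ) * (1 / (a - z) * (1 / (ζ - z))) := by
      field_simp
      ring
    linear_combination (a - ζ) ^ q * (1 / (a - z)) ^ q * key

/-- The Cauchy kernels with poles in a compact set disjoint from `K` have exponentially small
widths. -/
theorem hasExpWidth_cauchyKernel [CompactSpace K] {F : Set ℂ} (hF : IsCompact F)
    (hFK : Disjoint F K) : ∃ (B : ℕ) (C : ℝ), 0 < B ∧ HasExpWidth (cauchyKernel K '' F) B C := by
  have hKc : IsCompact K := isCompact_iff_compactSpace.2 inferInstance
  obtain ⟨r, hr, hdist⟩ := hF.exists_thickening_subset_open hKc.isClosed.isOpen_compl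
    hFK.subset_compl_right
  have hsep : ∀ ζ ∈ F, ∀ z : K, r ≤ ‖ζ - z‖ := by
    intro ζ hζ z
    by_contra! h
    refine hdist (Metric.mem_thickening_iff.2 ⟨ζ, hζ, ?_⟩) z.2
    rwa [dist_comm, dist_eq_norm]
  have hFK' : ∀ ζ ∈ F, ζ ∉ K := fun ζ hζ => Set.disjoint_left.1 hFK hζ
  -- Poles are at distance at least `r` from `K`, so a net of mesh `r / 2` gives the expansion about
  -- a net point the ratio `1 / 2`.
  obtain ⟨Z, hZF, hZfin, hZ⟩ := hF.totallyBounded.exists_subset (Metric.dist_mem_uniformity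
    (half_pos hr))
  lift Z to Finset ℂ using hZfin
  -- The factor `2` counts real dimensions of complex multiples; the `+ 1` keeps `B` positive when
  -- `F` is empty.
  refine ⟨2 * Z.card + 1, 1 / r, by omega, fun q => ?_⟩
  let b : Z × Fin q × Fin 2 → C(K, ℂ) := fun i =>
    (if i.2.2 = 0 then (1 : ℂ) else Complex.I) • cauchyKernel K i.1 ^ ((i.2.1 : ℕ) + 1)
  refine ⟨Submodule.span ℝ (Set.range b), FiniteDimensional.span_of_finite ℝ (Set.finite_range b), ?_, ?_⟩
  · refine (finrank_range_le_card (R := ℝ) b).trans ?_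
    simp only [Fintype.card_prod, Fintype.card_coe, Fintype.card_fin]
    nlinarith
  · rintro _ ⟨ζ, hζ, rfl⟩
    obtain ⟨a, haZ, hζa⟩ := Set.mem_iUnion₂.1 (hZ hζ)
    have haF : a ∈ F := hZF haZ
    refine ⟨∑ k ∈ Finset.range q, (a - ζ) ^ k • cauchyKernel K a ^ (k + 1), ?_, ?_⟩
    · refine Submodule.sum_mem _ fun k hk => ?_
      have h0 : b (⟨a, haZ⟩, ⟨k, Finset.mem_range.1 hk⟩, 0) = cauchyKernel K a ^ (k + 1) := by
        simp [b]
      have h1 : b (⟨a, haZ⟩, ⟨k, Finset.mem_range.1 hk⟩, 1) =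
          Complex.I • cauchyKernel K a ^ (k + 1) := by
        simp [b]
      have : (a - ζ) ^ k • cauchyKernel K a ^ (k + 1) =
          ((a - ζ) ^ k).re • cauchyKernel K a ^ (k + 1) +
            ((a - ζ) ^ k).im • (Complex.I • cauchyKernel K a ^ (k + 1)) := by
        ext z
        simp only [ContinuousMap.add_apply, ContinuousMap.smul_apply, smul_eq_mul,
          Complex.real_smul]
        conv_lhs => rw [← Complex.re_add_im ((a - ζ) ^ k)]
        ring
      rw [this, ← h1, ← h0]
      exact Submodule.add_mem _ (Submodule.smul_mem _ _ (Submodule.subset_span ⟨_, rfl⟩))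
        (Submodule.smul_mem _ _ (Submodule.subset_span ⟨_, rfl⟩))
    · have : cauchyKernel K ζ - ∑ k ∈ Finset.range q, (a - ζ) ^ k • cauchyKernel K a ^ (k + 1) =
          (a - ζ) ^ q • (cauchyKernel K a ^ q * cauchyKernel K ζ) := by
        rw [sub_eq_iff_eq_add']
        exact cauchyKernel_eq_sum_add (hFK' a haF) (hFK' ζ hζ) q
      rw [this, ContinuousMap.norm_le _ (by positivity)]
      intro z
      have h1 := hsep a haF z
      have h2 := hsep ζ hζ z
      have h3 : ‖a - ζ‖ ≤ r / 2 := by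
        rw [norm_sub_rev, ← dist_eq_norm]
        exact le_of_lt hζa
      simp only [ContinuousMap.smul_apply, ContinuousMap.mul_apply, ContinuousMap.pow_apply,
        cauchyKernel_apply (hFK' a haF), cauchyKernel_apply (hFK' ζ hζ), smul_eq_mul, norm_mul,
        norm_pow, norm_div, norm_one]
      calc ‖a - ζ‖ ^ q * ((1 / ‖a - z‖) ^ q * (1 / ‖ζ - z‖))
          ≤ (r / 2) ^ q * ((1 / r) ^ q * (1 / r)) := by gcongr
        _ = 1 / r * (r / 2 * (1 / r)) ^ q := by rw [mul_pow]; ring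
        _ = 1 / r * (1 / 2) ^ q := by congr 2; field_simp

end CauchyKernel

/-! ### The Cauchy–Pompeiu formula and annihilation of holomorphic functions -/

open MeasureTheory in
theorem integral_fderiv_ray {u : ℂ → ℂ} (hu : ContDiff ℝ 1 u) {R : ℝ} (hR : 0 ≤ R) (e : ℂ)
    (hz : u (R * e) = 0) : ∫ r in Set.Ioc 0 R, fderiv ℝ u (r * e) e = - u 0 := by
  rw [← intervalIntegral.integral_of_le hR]
  have hd : ∀ r : ℝ, HasDerivAt (fun r : ℝ => u (r * e)) (fderiv ℝ u (r * e) e) r := by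
    intro r
    have h1 : HasDerivAt (fun r : ℝ => (r : ℂ) * e) e r := by
      simpa using (Complex.ofRealCLM.hasDerivAt (x := r)).mul_const e
    exact ((hu.differentiable one_ne_zero) _).hasFDerivAt.comp_hasDerivAt r h1
  rw [intervalIntegral.integral_eq_sub_of_hasDerivAt (fun r _ => hd r), hz]
  · simp
  · refine Continuous.intervalIntegrable ?_ _ _
    have := hu.continuous_fderiv one_ne_zero
    fun_prop

open MeasureTheory in
theorem integral_fderiv_circle {u : ℂ → ℂ} (hu : ContDiff ℝ 1 u) {r : ℝ} (hr : r ≠ 0) :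
    ∫ t in Set.Ioo (-Real.pi) Real.pi, fderiv ℝ u (r * Complex.exp (t * Complex.I))
      (Complex.I * Complex.exp (t * Complex.I)) = 0 := by
  rw [← integral_Ioc_eq_integral_Ioo, ← intervalIntegral.integral_of_le (by linarith [Real.pi_pos])]
  have hd : ∀ t : ℝ, HasDerivAt (fun t : ℝ => r⁻¹ • u (r * Complex.exp (t * Complex.I)))
      (fderiv ℝ u (r * Complex.exp (t * Complex.I)) (Complex.I * Complex.exp (t * Complex.I))) t := by
    intro t
    have h1 : HasDerivAt (fun t : ℝ => (r : ℂ) * Complex.exp (t * Complex.I))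
        (r * (Complex.exp (t * Complex.I) * (1 * Complex.I))) t := by
      exact (((Complex.ofRealCLM.hasDerivAt (x := t)).mul_const Complex.I).cexp).const_mul (r : ℂ)
    have h2 := (((hu.differentiable one_ne_zero) _).hasFDerivAt.comp_hasDerivAt t h1).const_smul r⁻¹
    convert! h2 using 1
    have : (r : ℂ) * (Complex.exp (t * Complex.I) * (1 * Complex.I)) =
        r • (Complex.I * Complex.exp (t * Complex.I)) := by
      rw [Complex.real_smul]; ring
    rw [this, map_smul, smul_smul, inv_mul_cancel₀ hr, one_smul]
  rw [intervalIntegral.integral_eq_sub_of_hasDerivAt (fun t _ => hd t)]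
  · have h1 : Complex.exp ((Real.pi : ℝ) * Complex.I) = Complex.exp ((-Real.pi : ℝ) * Complex.I) := by
      push_cast
      rw [neg_mul, Complex.exp_neg, Complex.exp_pi_mul_I]
      norm_num
    rw [h1, sub_self]
  · refine Continuous.intervalIntegrable ?_ _ _
    have := hu.continuous_fderiv one_ne_zero
    fun_prop

/-- The Cauchy–Riemann operator. -/
noncomputable def dbar (u : ℂ → ℂ) (z : ℂ) : ℂ :=
  (fderiv ℝ u z 1 + Complex.I * fderiv ℝ u z Complex.I) / 2

/-- In polar coordinates the Jacobian cancels the modulus of `1 / ζ`, leaving half a radial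
derivative, integrated along rays, and an angular one, which integrates to zero over circles. -/
theorem dbar_polar (u : ℂ → ℂ) (z : ℂ) (t : ℝ) :
    dbar u z * Complex.exp (-(t * Complex.I)) =
      (fderiv ℝ u z (Complex.exp (t * Complex.I)) +
        Complex.I * fderiv ℝ u z (Complex.I * Complex.exp (t * Complex.I))) / 2 := by
  have hlin : ∀ a b : ℝ, fderiv ℝ u z (a + b * Complex.I) =
      a * fderiv ℝ u z 1 + b * fderiv ℝ u z Complex.I := by
    intro a b
    have : (a + b * Complex.I : ℂ) = a • (1 : ℂ) + b • Complex.I := by simp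
    rw [this, map_add, map_smul, map_smul, Complex.real_smul, Complex.real_smul]
  have h1 : Complex.exp (t * Complex.I) = (Real.cos t : ℝ) + (Real.sin t : ℝ) * Complex.I := by
    rw [Complex.exp_mul_I]; push_cast; rfl
  have h2 : Complex.I * Complex.exp (t * Complex.I) =
      ((-Real.sin t : ℝ) : ℂ) + (Real.cos t : ℝ) * Complex.I := by
    rw [h1]; push_cast; linear_combination (Complex.sin t) * Complex.I_mul_I
  have h3 : Complex.exp (-(t * Complex.I)) = (Real.cos t : ℝ) - (Real.sin t : ℝ) * Complex.I := by
    rw [← neg_mul, ← Complex.ofReal_neg, Complex.exp_mul_I]; push_cast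
    rw [Complex.cos_neg, Complex.sin_neg]; ring
  rw [h2, h1, h3, hlin, hlin, dbar]
  push_cast
  linear_combination (-(Complex.sin t) * fderiv ℝ u z Complex.I / 2) * Complex.I_mul_I

open MeasureTheory in
/-- The Cauchy–Pompeiu formula for compactly supported functions. -/
theorem integral_dbar_div {u : ℂ → ℂ} (hu : ContDiff ℝ 1 u) (hs : HasCompactSupport u) :
    ∫ ζ, dbar u ζ / ζ = -Real.pi * u 0 := by
  obtain ⟨R, hR0, hR⟩ := hs.isCompact.isBounded.exists_pos_norm_le
  have hdu := hu.continuous_fderiv one_ne_zero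
  have hfz : ∀ z : ℂ, R < ‖z‖ → fderiv ℝ u z = 0 := by
    intro z hz
    have : z ∉ tsupport u := fun h => absurd (hR z h) (not_le.2 hz)
    exact Function.notMem_support.1 fun h => this (support_fderiv_subset ℝ h)
  have huz : ∀ z : ℂ, R < ‖z‖ → u z = 0 := by
    intro z hz
    exact image_eq_zero_of_notMem_tsupport fun h => absurd (hR z h) (not_le.2 hz)
  let P : ℝ × ℝ → ℂ := fun p => fderiv ℝ u (p.1 * Complex.exp (p.2 * Complex.I))
    (Complex.exp (p.2 * Complex.I))
  let Q : ℝ × ℝ → ℂ := fun p => fderiv ℝ u (p.1 * Complex.exp (p.2 * Complex.I))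
    (Complex.I * Complex.exp (p.2 * Complex.I))
  have hPc : Continuous P := by fun_prop
  have hQc : Continuous Q := by fun_prop
  set S := R + 1 with hS
  have hint : ∀ G : ℝ × ℝ → ℂ, Continuous G →
      IntegrableOn G (Set.Ioc 0 S ×ˢ Set.Ioo (-Real.pi) Real.pi) volume := fun G hG =>
    (hG.continuousOn.integrableOn_compact (isCompact_Icc.prod isCompact_Icc)).mono_set
      (Set.prod_mono Set.Ioc_subset_Icc_self Set.Ioo_subset_Icc_self)
  have hnorm : ∀ (r t : ℝ), ‖(r : ℂ) * Complex.exp (t * Complex.I)‖ = |r| := by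
    intro r t
    rw [norm_mul, Complex.norm_exp_ofReal_mul_I, mul_one, Complex.norm_real, Real.norm_eq_abs]
  have hPint : ∫ p in Set.Ioc 0 S ×ˢ Set.Ioo (-Real.pi) Real.pi, P p = -(2 * Real.pi) * u 0 := by
    rw [Measure.volume_eq_prod, ← setIntegral_prod_swap, setIntegral_prod]
    · have : ∀ t : ℝ, ∫ r in Set.Ioc 0 S, P (Prod.swap (t, r)) = -u 0 := by
        intro t
        refine integral_fderiv_ray hu (R := S) (by linarith) (Complex.exp (t * Complex.I)) (huz _ ?_)
        rw [hnorm, abs_of_pos (by linarith)]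
        linarith
      simp only [this, integral_const, MeasurableSet.univ, measureReal_restrict_apply,
        Set.univ_inter, Real.volume_real_Ioo, Complex.real_smul]
      rw [max_eq_left (by linarith [Real.pi_pos])]
      push_cast; ring
    · exact (hint P hPc).swap
  have hQint : ∫ p in Set.Ioc 0 S ×ˢ Set.Ioo (-Real.pi) Real.pi, Q p = 0 := by
    rw [Measure.volume_eq_prod, setIntegral_prod _ (hint Q hQc)]
    refine setIntegral_eq_zero_of_forall_eq_zero fun r hr => ?_
    exact integral_fderiv_circle hu hr.1.ne'
  rw [← Complex.integral_comp_polarCoord_symm]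
  have h1 : ∀ p ∈ Complex.polarCoord.target,
      p.1 • (dbar u (Complex.polarCoord.symm p) / Complex.polarCoord.symm p) =
        (P p + Complex.I * Q p) / 2 := by
    rintro ⟨r, t⟩ ⟨hr, -⟩
    have hr0 : (r : ℂ) ≠ 0 := by exact_mod_cast (ne_of_gt hr)
    have hsymm : Complex.polarCoord.symm (r, t) = r * Complex.exp (t * Complex.I) := by
      rw [Complex.polarCoord_symm_apply, Complex.exp_mul_I]; push_cast; rfl
    rw [hsymm]
    simp only [P, Q]
    rw [← dbar_polar, Complex.exp_neg, Complex.real_smul]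
    have := Complex.exp_ne_zero (t * Complex.I)
    field_simp
  have h2 : Complex.polarCoord.target = Set.Ioi (0 : ℝ) ×ˢ Set.Ioo (-Real.pi) Real.pi := rfl
  have htm : MeasurableSet (Set.Ioi (0 : ℝ) ×ˢ Set.Ioo (-Real.pi) Real.pi) :=
    measurableSet_Ioi.prod measurableSet_Ioo
  have h3 : ∫ p in Set.Ioi (0 : ℝ) ×ˢ Set.Ioo (-Real.pi) Real.pi, (P p + Complex.I * Q p) / 2 =
      ∫ p in Set.Ioc 0 S ×ˢ Set.Ioo (-Real.pi) Real.pi, (P p + Complex.I * Q p) / 2 := by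
    refine setIntegral_eq_of_subset_of_forall_sdiff_eq_zero htm
      (Set.prod_mono Set.Ioc_subset_Ioi_self le_rfl) ?_
    rintro ⟨r, t⟩ ⟨⟨hr, ht⟩, hn⟩
    have hrS : S < r := by
      by_contra! h
      exact hn ⟨⟨hr, h⟩, ht⟩
    have : fderiv ℝ u (r * Complex.exp (t * Complex.I)) = 0 := by
      refine hfz _ ?_
      rw [hnorm, abs_of_pos hr]
      linarith
    simp [P, Q, this]
  have h4 : ∫ p in Set.Ioc 0 S ×ˢ Set.Ioo (-Real.pi) Real.pi, (P p + Complex.I * Q p) / 2 =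
      (-(2 * Real.pi) * u 0 + Complex.I * 0) / 2 := by
    rw [integral_div, integral_add (hint P hPc) ((hint Q hQc).const_mul _), integral_const_mul,
      hPint, hQint]
  have h5 : ∫ p in polarCoord.target,
      p.1 • (dbar u (Complex.polarCoord.symm p) / Complex.polarCoord.symm p) =
      ∫ p in polarCoord.target, (P p + Complex.I * Q p) / 2 := setIntegral_congr_fun htm h1
  rw [h5]
  refine h3.trans (h4.trans ?_)
  ring

theorem dbar_eq_zero_of_differentiableAt {u : ℂ → ℂ} {z : ℂ} (h : DifferentiableAt ℂ u z) :
    dbar u z = 0 := by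
  have h1 : fderiv ℝ u z = (fderiv ℂ u z).restrictScalars ℝ :=
    (h.hasFDerivAt.restrictScalars ℝ).fderiv
  have h2 : fderiv ℂ u z Complex.I = Complex.I * fderiv ℂ u z 1 := by
    rw [← smul_eq_mul, ← map_smul]; simp
  rw [dbar, h1]
  simp only [ContinuousLinearMap.coe_restrictScalars', h2]
  linear_combination (fderiv ℂ u z 1 / 2) * Complex.I_mul_I

open MeasureTheory in
theorem integral_dbar_mul_cauchy {u : ℂ → ℂ} (hu : ContDiff ℝ 1 u) (hs : HasCompactSupport u)
    (z : ℂ) : ∫ ζ, dbar u ζ * (1 / (ζ - z)) = -Real.pi * u z := by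
  have h1 := integral_dbar_div (u := fun ζ => u (ζ + z)) (hu.comp (contDiff_id.add contDiff_const))
    (hs.comp_homeomorph (Homeomorph.addRight z))
  rw [zero_add] at h1
  rw [← h1, ← integral_add_right_eq_self _ z]
  refine integral_congr_ae (Filter.Eventually.of_forall fun ζ => ?_)
  have : dbar (fun ζ => u (ζ + z)) ζ = dbar u (ζ + z) := by
    simp only [dbar, fderiv_comp_add_right]
  simp only [this, add_sub_cancel_right]
  ring

open MeasureTheory in
/-- A functional annihilating the Cauchy kernels with poles off `K` annihilates all functions
holomorphic near `K`. -/
theorem annihilates_of_cauchyKernel {K D : Set ℂ} [CompactSpace K] (hD : IsOpen D) (hKD : K ⊆ D)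
    {L : C(K, ℂ) →L[ℂ] ℂ} (hL : ∀ ζ ∉ K, L (cauchyKernel K ζ) = 0) {g : ℂ → ℂ}
    (hg : DifferentiableOn ℂ g D) {x : C(K, ℂ)} (hx : ∀ z : K, x z = g z) : L x = 0 := by
  have hKc : IsCompact K := isCompact_iff_compactSpace.2 inferInstance
  obtain ⟨K2, hK2, hK1, hK2D⟩ := exists_compact_between hKc hD hKD
  obtain ⟨χ, h0, h1, -⟩ := exists_contMDiffMap_zero_one_nhds_of_isClosed (n := 1)
    (modelWithCornersSelf ℝ ℂ) isOpen_interior.isClosed_compl hKc.isClosed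
    (Set.disjoint_left.2 fun z hz hzK => hz (hK1 hzK))
  have hχ : ContDiff ℝ 1 χ := χ.contMDiff.contDiff
  -- A compactly supported function equal to `g` near `K`, so that `dbar u` vanishes near `K`.
  let u : ℂ → ℂ := fun z => (χ z : ℂ) * g z
  have hu0 : ∀ z ∉ interior K2, u =ᶠ[nhds z] 0 := by
    intro z hz
    filter_upwards [eventually_nhdsSet_iff_forall.1 h0 z hz] with y hy
    simp [u, hy]
  have huK : ∀ z ∈ K, u =ᶠ[nhds z] g := by
    intro z hz
    filter_upwards [eventually_nhdsSet_iff_forall.1 h1 z hz] with y hy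
    simp [u, hy]
  have hu : ContDiff ℝ 1 u := by
    refine contDiff_iff_contDiffAt.2 fun z => ?_
    by_cases hz : z ∈ interior K2
    · have hgz : ContDiffAt ℝ 1 g z :=
        ((hg.analyticAt (hD.mem_nhds (hK2D (interior_subset hz)))).contDiffAt).restrict_scalars ℝ
      exact (Complex.ofRealCLM.contDiff.contDiffAt.comp z hχ.contDiffAt).mul hgz
    · exact contDiffAt_const.congr_of_eventuallyEq (hu0 z hz)
  have hus : HasCompactSupport u := by
    refine HasCompactSupport.intro hK2 fun z hz => ?_
    exact (hu0 z fun h => hz (interior_subset h)).eq_of_nhds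
  have hdK : ∀ z ∈ K, dbar u =ᶠ[nhds z] 0 := by
    intro z hz
    filter_upwards [(huK z hz).eventually_nhds, hD.mem_nhds (hKD hz)] with y hy hyD
    have : DifferentiableAt ℂ u y :=
      (hg.differentiableAt (hD.mem_nhds hyD)).congr_of_eventuallyEq hy
    exact dbar_eq_zero_of_differentiableAt this
  have hdc : Continuous (dbar u) := by
    have := hu.continuous_fderiv one_ne_zero
    unfold dbar
    fun_prop
  have hds : HasCompactSupport (dbar u) := by
    refine (hus.fderiv ℝ).mono' fun z hz => ?_
    by_contra hcon
    refine hz ?_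
    have : fderiv ℝ u z = 0 := image_eq_zero_of_notMem_tsupport hcon
    simp [dbar, this]
  -- By Cauchy–Pompeiu, `x` is `-1 / π` times the `C(K, ℂ)`-valued integral of `H`, and `L` passes
  -- under the integral. The singular kernels with poles on `K` are multiplied by zero.
  let H : ℂ → C(K, ℂ) := fun ζ => dbar u ζ • cauchyKernel K ζ
  have hHc : Continuous H := by
    refine continuous_iff_continuousAt.2 fun ζ => ?_
    by_cases hζ : ζ ∈ K
    · refine (continuousAt_const (y := (0 : C(K, ℂ)))).congr ?_
      filter_upwards [hdK ζ hζ] with y hy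
      simp [H, hy]
    · exact hdc.continuousAt.smul (differentiableAt_cauchyKernel hζ).continuousAt
  have hHi : Integrable H := hHc.integrable_of_hasCompactSupport hds.smul_right
  have hval : ∫ ζ, H ζ = (-Real.pi : ℂ) • x := by
    ext z
    rw [ContinuousMap.integral_apply hHi]
    have h2 : ∀ ζ, H ζ z = dbar u ζ * (1 / (ζ - z)) := by
      intro ζ
      by_cases hζ : ζ ∈ K
      · have : dbar u ζ = 0 := (hdK ζ hζ).eq_of_nhds
        simp [H, this]
      · simp [H, cauchyKernel_apply hζ]
    simp only [h2, integral_dbar_mul_cauchy hu hus, ContinuousMap.smul_apply, smul_eq_mul, hx,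
      (huK z z.2).eq_of_nhds]
  have h3 : L (∫ ζ, H ζ) = 0 := by
    rw [← ContinuousLinearMap.integral_comp_comm L hHi]
    refine integral_eq_zero_of_ae (Filter.Eventually.of_forall fun ζ => ?_)
    by_cases hζ : ζ ∈ K
    · have : dbar u ζ = 0 := (hdK ζ hζ).eq_of_nhds
      simp [H, this]
    · simp [H, hL ζ hζ]
  rw [hval, map_smul, smul_eq_mul] at h3
  exact (mul_eq_zero.1 h3).resolve_left (by simp [Real.pi_ne_zero])

/-! ### Integrating logarithmic derivatives -/

/-- On a connected open set, a holomorphic function vanishing at a point is controlled on compact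
sets by its derivative on compact sets. -/
theorem exists_norm_le_of_norm_deriv_le {D : Set ℂ} (hD : IsOpen D) (hDc : IsPreconnected D)
    {z₀ : ℂ} (hz₀ : z₀ ∈ D) {K : Set ℂ} (hK : IsCompact K) (hKD : K ⊆ D) :
    ∃ K₁ : Set ℂ, IsCompact K₁ ∧ K₁ ⊆ D ∧ ∃ C : ℝ, 0 ≤ C ∧ ∀ F : ℂ → ℂ, DifferentiableOn ℂ F D →
      F z₀ = 0 → ∀ m : ℝ, 0 ≤ m → (∀ z ∈ K₁, ‖deriv F z‖ ≤ m) → ∀ z ∈ K, ‖F z‖ ≤ C * m := by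
  let P : Set ℂ → Prop := fun t =>
    ∃ K₁ : Set ℂ, IsCompact K₁ ∧ K₁ ⊆ D ∧ ∃ C : ℝ, 0 ≤ C ∧ ∀ F : ℂ → ℂ, DifferentiableOn ℂ F D →
      F z₀ = 0 → ∀ m : ℝ, 0 ≤ m → (∀ z ∈ K₁, ‖deriv F z‖ ≤ m) → ∀ z ∈ t, ‖F z‖ ≤ C * m
  have hmono : ∀ s t, s ⊆ t → P t → P s := by
    rintro s t hst ⟨K₁, h1, h2, C, hC, h⟩
    exact ⟨K₁, h1, h2, C, hC, fun F hF h0 m hm hd z hz => h F hF h0 m hm hd z (hst hz)⟩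
  have hball : ∀ z r, 0 < r → Metric.closedBall z r ⊆ D → ∀ w ∈ Metric.ball z r, P {w} →
      P (Metric.ball z r) := by
    rintro z r hr hzr w hw ⟨K₁, h1, h2, C, hC, h⟩
    refine ⟨K₁ ∪ Metric.closedBall z r, h1.union (isCompact_closedBall z r),
      Set.union_subset h2 hzr, C + 2 * r, by positivity, fun F hF h0 m hm hd y hy => ?_⟩
    have hFw := h F hF h0 m hm (fun x hx => hd x (Or.inl hx)) w rfl
    have hsub : Metric.ball z r ⊆ Metric.closedBall z r := Metric.ball_subset_closedBall
    have hmv := Convex.norm_image_sub_le_of_norm_deriv_le (𝕜 := ℂ) (f := F) (s := Metric.ball z r)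
      (fun x hx => hF.differentiableAt (hD.mem_nhds (hzr (hsub hx))))
      (fun x hx => hd x (Or.inr (hsub hx))) (convex_ball z r) hw hy
    have hyw : ‖y - w‖ ≤ 2 * r := by
      rw [← dist_eq_norm]
      have := dist_triangle_right y w z
      rw [Metric.mem_ball] at hy hw
      linarith
    calc ‖F y‖ ≤ ‖F w‖ + ‖F y - F w‖ := norm_le_insert' _ _
      _ ≤ C * m + m * (2 * r) := by gcongr; exact hmv.trans (by gcongr)
      _ = (C + 2 * r) * m := by ring
  -- The points near which the estimate holds form an open and relatively closed subset of `D`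
  -- containing `z₀`; compactness then reaches `K`.
  let u : Set ℂ := {z | ∃ t ∈ nhds z, P t}
  have hu : IsOpen u := by
    refine isOpen_iff_mem_nhds.2 fun z hz => ?_
    obtain ⟨t, ht, hP⟩ := hz
    filter_upwards [eventually_mem_nhds_iff.2 ht] with y hy using ⟨t, hy, hP⟩
  have h0u : z₀ ∈ u := by
    obtain ⟨r, hr, hrD⟩ := Metric.nhds_basis_closedBall.mem_iff.1 (hD.mem_nhds hz₀)
    refine ⟨_, Metric.ball_mem_nhds z₀ hr, hball z₀ r hr hrD z₀ (Metric.mem_ball_self hr) ?_⟩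
    refine ⟨∅, isCompact_empty, Set.empty_subset _, 0, le_rfl, fun F _ h0 m _ _ z hz => ?_⟩
    rw [Set.mem_singleton_iff.1 hz, h0]
    simp
  have hcl : closure u ∩ D ⊆ u := by
    rintro z ⟨hzu, hzD⟩
    obtain ⟨r, hr, hrD⟩ := Metric.nhds_basis_closedBall.mem_iff.1 (hD.mem_nhds hzD)
    obtain ⟨w, ⟨t, ht, hPt⟩, hwz⟩ := Metric.mem_closure_iff.1 hzu r hr
    refine ⟨_, Metric.ball_mem_nhds z hr, hball z r hr hrD w ?_
      (hmono _ t (Set.singleton_subset_iff.2 (mem_of_mem_nhds ht)) hPt)⟩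
    rwa [Metric.mem_ball, dist_comm]
  have hDu := hDc.subset_of_closure_inter_subset hu ⟨z₀, hz₀, h0u⟩ hcl
  refine hK.induction_on (p := P) ?_ hmono ?_ ?_
  · exact ⟨∅, isCompact_empty, Set.empty_subset _, 0, le_rfl, fun F _ _ m _ _ z hz => hz.elim⟩
  · rintro s t ⟨K₁, h1, h2, C, hC, h⟩ ⟨K₂, h1', h2', C', hC', h'⟩
    refine ⟨K₁ ∪ K₂, h1.union h1', Set.union_subset h2 h2', C + C', by positivity,
      fun F hF h0 m hm hd z hz => ?_⟩
    rw [add_mul]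
    rcases hz with hz | hz
    · have := h F hF h0 m hm (fun x hx => hd x (Or.inl hx)) z hz
      linarith [mul_nonneg hC' hm]
    · have := h' F hF h0 m hm (fun x hx => hd x (Or.inr hx)) z hz
      linarith [mul_nonneg hC hm]
  · intro z hz
    obtain ⟨t, ht, hP⟩ := hDu (hKD hz)
    exact ⟨t, mem_nhdsWithin_of_mem_nhds ht, hP⟩

/-- Zero-free holomorphic functions on simply connected domains have holomorphic logarithms. -/
theorem IsSimplyConnected.exists_holomorphic_log {D : Set ℂ} (hD : IsOpen D)
    (hs : IsSimplyConnected D) {f : ℂ → ℂ} (hf : DifferentiableOn ℂ f D) (hf0 : ∀ z ∈ D, f z ≠ 0) :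
    ∃ l : ℂ → ℂ, DifferentiableOn ℂ l D ∧ ∀ z ∈ D, Complex.exp (l z) = f z := by
  obtain ⟨l, hl, he⟩ := Complex.exists_continuousOn_eqOn_exp_comp hs hD hf.continuousOn
    (by rintro ⟨z, hz, h⟩; exact hf0 z hz h)
  refine ⟨l, fun z hz => DifferentiableAt.differentiableWithinAt ?_, he⟩
  have hD' := hD.mem_nhds hz
  have hexp := Complex.hasStrictDerivAt_exp (l z)
  -- A continuous logarithm is locally a holomorphic inverse of `exp` composed with `f`.
  obtain ⟨ψ, h1, hleft⟩ : ∃ ψ : ℂ → ℂ, DifferentiableAt ℂ ψ (Complex.exp (l z)) ∧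
      ∀ᶠ x in nhds (l z), ψ (Complex.exp x) = x :=
    ⟨_, (hexp.to_localInverse (Complex.exp_ne_zero _)).hasDerivAt.differentiableAt,
      hexp.eventually_left_inverse (Complex.exp_ne_zero _)⟩
  have hez : Complex.exp (l z) = f z := he hz
  rw [hez] at h1
  refine (h1.comp z (hf.differentiableAt hD')).congr_of_eventuallyEq ?_
  filter_upwards [(hl.continuousAt hD').eventually hleft, hD'] with y hy hyD
  have hey : Complex.exp (l y) = f y := he hyD
  rw [Function.comp_apply, ← hey, hy]

/-! ### From separation to polynomial approximation -/

/-- Sums of Cauchy kernels with poles in a compact set separating `D` from infinity approximate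
holomorphic functions. -/
theorem exists_multiset_cauchyKernel_near {D F : Set ℂ} (hD : IsOpen D) (hs : IsSimplyConnected D)
    (hF : IsCompact F) (hFD : Disjoint F D) {p : ℂ} (hp : p ∈ D)
    (hb : Bornology.IsBounded (connectedComponentIn Fᶜ p)) {K : Set ℂ} [CompactSpace K]
    (hKD : K ⊆ D) (hKc : IsPreconnected Kᶜ) {g : ℂ → ℂ} (hg : DifferentiableOn ℂ g D) {x : C(K, ℂ)}
    (hx : ∀ z : K, x z = g z) {η : ℝ} (hη : 0 < η) :
    ∃ w ∈ AddSubmonoid.closure (cauchyKernel K '' F), ‖x - w‖ ≤ η := by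
  have hFK : Disjoint F K := hFD.mono_right hKD
  obtain ⟨B, C, hB, hW⟩ := hasExpWidth_cauchyKernel hF hFK
  obtain ⟨δ, hδ, hmain⟩ := hW.exists_mem_addSubmonoid_closure hB hη
  have hnK : ∀ ζ ∈ F, ζ ∉ K := fun ζ hζ => Set.disjoint_left.1 hFK hζ
  have hcont : ContinuousOn (cauchyKernel K) F := fun ζ hζ =>
    (differentiableAt_cauchyKernel (hnK ζ hζ)).continuousAt.continuousWithinAt
  obtain ⟨δ', hδ', hunif⟩ := Metric.uniformContinuousOn_iff.1
    (hF.uniformContinuousOn_of_continuous hcont) δ hδ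
  have hpF : p ∉ F := fun h => Set.disjoint_left.1 hFD h hp
  obtain ⟨A, hAF, hAcl, hAch, hAb⟩ := exists_isChainConnected_separating hF hpF hb hδ'
  have hAc : IsCompact A := hF.of_isClosed_subset hAcl hAF
  have hAne : A.Nonempty := by
    by_contra hcon
    rw [Set.not_nonempty_iff_eq_empty] at hcon
    rw [hcon, Set.compl_empty, connectedComponentIn_univ, PreconnectedSpace.connectedComponent_eq_univ] at hAb
    exact noncompact_univ ℂ (Metric.isCompact_of_isClosed_isBounded isClosed_univ hAb)
  have hch : IsChainConnected (cauchyKernel K '' A) δ := by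
    rintro _ ⟨a, ha, rfl⟩ _ ⟨b, hb, rfl⟩
    refine Relation.ReflTransGen.lift (cauchyKernel K) ?_ _ _ (hAch a ha b hb)
    exact fun x y h => ⟨⟨x, h.1, rfl⟩, ⟨y, h.2.1, rfl⟩, hunif x (hAF h.1) y (hAF h.2.1) h.2.2⟩
  have hDU : D ⊆ connectedComponentIn Aᶜ p :=
    hs.isPathConnected.isConnected.isPreconnected.subset_connectedComponentIn hp
      fun z hz h => Set.disjoint_left.1 hFD (hAF h) hz
  obtain ⟨w, hw, hxw⟩ := hmain (cauchyKernel K '' A) (Set.image_mono hAF) (hAne.image _)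
    (hAc.image_of_continuousOn (hcont.mono hAF)).totallyBounded hch x
    fun w hw ε hε => exists_integer_mass_combination (hAne.image _) (fun l hl => by
      -- The complex-linear functional with real part `l`, to which the Cauchy transform argument
      -- applies.
      set L : C(K, ℂ) →L[ℂ] ℂ := StrongDual.extendRCLike l with hL
      have hlL : ∀ y, (L y).re = l y := fun y => StrongDual.re_extendRCLike_apply (𝕜 := ℂ) l y
      have hL0 : ∀ ζ ∉ K, L (cauchyKernel K ζ) = 0 := fun ζ hζ =>
        cauchyKernel_annihilated_of_nonneg hKc (hKD.trans hDU)
          hAcl.isOpen_compl.connectedComponentIn hAb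
          (frontier_connectedComponentIn_compl_subset hAcl p) hlL (fun ζ hζ => hl _ ⟨ζ, hζ, rfl⟩) hζ
      refine ⟨?_, ?_⟩
      · rintro _ ⟨ζ, hζ, rfl⟩
        rw [← hlL, hL0 ζ (hnK ζ (hAF hζ)), Complex.zero_re]
      · rw [← hlL, annihilates_of_cauchyKernel hD hKD hL0 hg hx, Complex.zero_re]) hw hε
  exact ⟨w, AddSubmonoid.closure_mono (Set.image_mono hAF) hw, hxw⟩

theorem exists_multiset_eq_sum_cauchyKernel {K Γ : Set ℂ} {w : C(K, ℂ)}
    (hw : w ∈ AddSubmonoid.closure (cauchyKernel K '' Γ)) :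
    ∃ m : Multiset ℂ, (∀ ζ ∈ m, ζ ∈ Γ) ∧ w = (m.map (cauchyKernel K)).sum := by
  induction hw using AddSubmonoid.closure_induction with
  | mem t ht =>
    obtain ⟨ζ, hζ, rfl⟩ := ht
    exact ⟨{ζ}, by simpa using hζ, by simp⟩
  | zero => exact ⟨0, by simp, by simp⟩
  | add a b _ _ ha hb =>
    obtain ⟨m, hm, rfl⟩ := ha
    obtain ⟨n, hn, rfl⟩ := hb
    refine ⟨m + n, fun ζ hζ => ?_, by simp⟩
    rcases Multiset.mem_add.1 hζ with h | h
    exacts [hm ζ h, hn ζ h]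

theorem addSubmonoid_closure_cauchyKernel_le {K Γ : Set ℂ} [CompactSpace K]
    (h : Disjoint (closure Γ) K) : AddSubmonoid.closure (cauchyKernel K '' closure Γ) ≤
      (AddSubmonoid.closure (cauchyKernel K '' Γ)).topologicalClosure := by
  rw [AddSubmonoid.closure_le]
  have hcont : ContinuousOn (cauchyKernel K) (closure Γ) := fun ζ hζ =>
    (differentiableAt_cauchyKernel (Set.disjoint_left.1 h hζ)).continuousAt.continuousWithinAt
  exact hcont.image_closure.trans (closure_mono AddSubmonoid.subset_closure)

/-- Sums of `1 / (ζ - z)` with poles in a bounded set whose closure separates `D` from infinity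
approximate holomorphic functions uniformly on compact sets. -/
theorem exists_multiset_sum_near {D Γ : Set ℂ} (hD : IsOpen D) (hs : IsSimplyConnected D)
    (hΓ : Bornology.IsBounded Γ) (hΓD : Disjoint (closure Γ) D) {p : ℂ} (hp : p ∈ D)
    (hb : Bornology.IsBounded (connectedComponentIn (closure Γ)ᶜ p)) {K : Set ℂ} (hK : IsCompact K)
    (hKD : K ⊆ D) {g : ℂ → ℂ} (hg : DifferentiableOn ℂ g D) {η : ℝ} (hη : 0 < η) :
    ∃ m : Multiset ℂ, (∀ ζ ∈ m, ζ ∈ Γ) ∧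
      ∀ z ∈ K, ‖g z - (m.map fun ζ => 1 / (ζ - z)).sum‖ ≤ η := by
  obtain ⟨K', hK', hKK', hK'D, hK'c⟩ := hs.exists_isCompact_preconnected_compl hD hK hKD
  have : CompactSpace K' := isCompact_iff_compactSpace.1 hK'
  let x : C(K', ℂ) := ⟨K'.domRestrict g, continuousOn_iff_continuous_domRestrict.1
    (hg.continuousOn.mono hK'D)⟩
  obtain ⟨w, hw, hxw⟩ := exists_multiset_cauchyKernel_near hD hs hΓ.isCompact_closure hΓD hp hb
    hK'D hK'c hg (x := x) (fun _ => rfl) (half_pos hη)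
  have hd : Disjoint (closure Γ) K' := hΓD.mono_right hK'D
  obtain ⟨w', hw', hww'⟩ := Metric.mem_closure_iff.1 (addSubmonoid_closure_cauchyKernel_le hd hw) _
    (half_pos hη)
  obtain ⟨m, hm, rfl⟩ := exists_multiset_eq_sum_cauchyKernel hw'
  refine ⟨m, hm, fun z hz => ?_⟩
  have hval : ∀ n : Multiset ℂ, (∀ ζ ∈ n, ζ ∈ Γ) → (n.map (cauchyKernel K')).sum ⟨z, hKK' hz⟩ =
      (n.map fun ζ => 1 / (ζ - z)).sum := by
    intro n
    induction n using Multiset.induction_on with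
    | empty => intro _; simp
    | cons ζ n ih =>
      intro hn
      have hζ : ζ ∉ K' := Set.disjoint_left.1 hd
        (subset_closure (hn ζ (Multiset.mem_cons_self _ _)))
      rw [Multiset.map_cons, Multiset.sum_cons, Multiset.map_cons, Multiset.sum_cons,
        ContinuousMap.add_apply, ih fun ξ hξ => hn ξ (Multiset.mem_cons_of_mem hξ),
        cauchyKernel_apply hζ]
  rw [← hval m hm]
  have hn := (x - (m.map (cauchyKernel K')).sum).norm_coe_le_norm ⟨z, hKK' hz⟩
  refine hn.trans ?_
  rw [dist_eq_norm] at hww'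
  calc ‖x - (m.map (cauchyKernel K')).sum‖ = ‖(x - w) + (w - (m.map (cauchyKernel K')).sum)‖ := by
        rw [sub_add_sub_cancel]
    _ ≤ η / 2 + η / 2 := norm_add_le_of_le hxw hww'.le
    _ = η := by ring

theorem Polynomial.eval_derivative_div_eval_eq_neg_sum {p : Polynomial ℂ} {z : ℂ}
    (hz : p.eval z ≠ 0) :
    p.derivative.eval z / p.eval z = -(p.roots.map fun ζ => 1 / (ζ - z)).sum := by
  rw [(IsAlgClosed.splits p).eval_derivative_div_eval_of_ne_zero hz, ← Multiset.sum_map_neg]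
  congr 1
  refine Multiset.map_congr rfl fun ζ _ => ?_
  rw [← neg_sub ζ z, one_div, one_div, inv_neg]

/-- If `P` has the chosen poles as roots, then `(log (f / P))' = f' / f + ∑ 1 / (ζ - z)` is small,
so `f / P` is nearly the constant `exp (l p)` on `K`. -/
theorem isPolyApproxSet_of_liesInBoundedComponent {D Γ : Set ℂ} (hD : IsOpen D)
    (hs : IsSimplyConnected D) (hΓ : Bornology.IsBounded Γ) (hΓD : Disjoint Γ D)
    (h : LiesInBoundedComponent D (closure Γ)) : IsPolyApproxSet Γ D := by
  obtain ⟨w, -, hwb, hDw⟩ := h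
  obtain ⟨p, hp⟩ := hs.nonempty
  rw [connectedComponentIn_eq (hDw hp)] at hwb
  intro f hf hf0 K hK hKD ε hε
  obtain ⟨K₁, hK₁, hK₁D, C, hC, hint⟩ := exists_norm_le_of_norm_deriv_le hD
    hs.isPathConnected.isConnected.isPreconnected hp hK hKD
  obtain ⟨M, hM0, hM⟩ : ∃ M : ℝ, 0 < M ∧ ∀ z ∈ K, ‖f z‖ ≤ M := by
    obtain ⟨M, hM⟩ := hK.exists_bound_of_continuousOn (hf.continuousOn.mono hKD)
    exact ⟨max M 1, lt_max_of_lt_right one_pos, fun z hz => (hM z hz).trans (le_max_left _ _)⟩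
  -- The bound `1` allows `‖exp w - 1‖ ≤ 2 * ‖w‖`, and `ε / (4 * M)` makes the final error at most
  -- `ε / 2`.
  set c : ℝ := min 1 (ε / (4 * M)) with hc
  have hc0 : 0 < c := lt_min one_pos (by positivity)
  set η : ℝ := c / (C + 1) with hη
  have hη0 : 0 < η := by positivity
  have hCη : C * η ≤ c := by
    rw [hη, mul_div_assoc', div_le_iff₀ (by positivity)]
    nlinarith
  have hfd : ∀ z ∈ D, HasDerivAt f (deriv f z) z := fun z hz =>
    (hf.differentiableAt (hD.mem_nhds hz)).hasDerivAt
  obtain ⟨m, hm, hmK⟩ := exists_multiset_sum_near hD hs hΓ (hΓD.closure_left hD) hp hwb hK₁ hK₁D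
    (g := fun z => -(deriv f z / f z)) ((hf.deriv hD).div hf hf0).neg hη0
  let P : Polynomial ℂ := (m.map fun ζ => Polynomial.X - Polynomial.C ζ).prod
  have hProots : P.roots = m := Polynomial.roots_multiset_prod_X_sub_C m
  have hP0 : P ≠ 0 := by
    refine Multiset.prod_ne_zero fun h => ?_
    obtain ⟨ζ, -, hζ⟩ := Multiset.mem_map.1 h
    exact Polynomial.X_sub_C_ne_zero ζ hζ
  have hPz : ∀ z, P.IsRoot z → z ∈ Γ := fun z hz => hm z (by
    rw [← hProots]; exact (Polynomial.mem_roots hP0).2 hz)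
  have hPD : ∀ z ∈ D, P.eval z ≠ 0 := fun z hz h0 => Set.disjoint_left.1 hΓD (hPz z h0) hz
  obtain ⟨l, hl, hle⟩ := hs.exists_holomorphic_log hD (f := fun z => f z / P.eval z)
    (hf.div P.differentiable.differentiableOn hPD) fun z hz => div_ne_zero (hf0 z hz) (hPD z hz)
  have hld : ∀ z ∈ D, deriv l z = deriv f z / f z + (m.map fun ζ => 1 / (ζ - z)).sum := by
    intro z hz
    have h1 := (hl.differentiableAt (hD.mem_nhds hz)).hasDerivAt.cexp
    have h2 := (hfd z hz).fun_div (P.hasDerivAt z) (hPD z hz)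
    have h3 := h1.unique (h2.congr_of_eventuallyEq (by
      filter_upwards [hD.mem_nhds hz] with y hy using hle y hy))
    have h4 := Polynomial.eval_derivative_div_eval_eq_neg_sum (hPD z hz)
    rw [hProots] at h4
    have h5 : (m.map fun ζ => 1 / (ζ - z)).sum = -(P.derivative.eval z / P.eval z) := by
      rw [h4, neg_neg]
    have hf0z := hf0 z hz
    have hPz := hPD z hz
    rw [hle z hz] at h3
    rw [h5]
    field_simp at h3 ⊢
    linear_combination h3
  have hF := hint (fun z => l z - l p) (hl.sub_const _) (sub_self _) η hη0.le fun z hz => by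
    rw [deriv_sub_const, hld z (hK₁D hz), ← norm_neg, neg_add]
    exact hmK z hz
  refine ⟨Polynomial.C (Complex.exp (l p)) * P, ⟨mul_ne_zero
    (Polynomial.C_ne_zero.2 (Complex.exp_ne_zero _)) hP0, fun z hz => hPz z ?_⟩, fun z hz => ?_⟩
  · rw [Polynomial.IsRoot, Polynomial.eval_mul, Polynomial.eval_C] at hz
    exact (mul_eq_zero.1 hz).resolve_left (Complex.exp_ne_zero _)
  · have hFz : ‖l z - l p‖ ≤ c := (hF z hz).trans hCη
    have hPz := hPD z (hKD hz)
    have hval : Complex.exp (l p) * P.eval z = f z * Complex.exp (-(l z - l p)) := by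
      rw [neg_sub, Complex.exp_sub, hle z (hKD hz)]
      have := hf0 z (hKD hz)
      field_simp
    rw [Polynomial.eval_mul, Polynomial.eval_C, hval]
    have h1 : f z - f z * Complex.exp (-(l z - l p)) = -(f z * (Complex.exp (-(l z - l p)) - 1)) := by
      ring
    rw [h1, norm_neg, norm_mul]
    have h2 := Complex.norm_exp_sub_one_le (x := -(l z - l p)) (by
      rw [norm_neg]; exact hFz.trans (min_le_left _ _))
    rw [norm_neg] at h2
    calc ‖f z‖ * ‖Complex.exp (-(l z - l p)) - 1‖ ≤ M * (2 * c) := by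
          gcongr
          · exact hM z hz
          · exact h2.trans (by linarith)
      _ ≤ M * (2 * (ε / (4 * M))) := by gcongr; exact min_le_right _ _
      _ = ε / 2 := by field_simp; ring
      _ < ε := half_lt_self hε

/-! ### From approximation to neutral families -/

theorem exists_norm_deriv_le {D : Set ℂ} (hD : IsOpen D) {K : Set ℂ} (hK : IsCompact K)
    (hKD : K ⊆ D) : ∃ K₁ : Set ℂ, IsCompact K₁ ∧ K ⊆ K₁ ∧ K₁ ⊆ D ∧ ∃ C : ℝ, 0 ≤ C ∧
      ∀ h : ℂ → ℂ, DifferentiableOn ℂ h D → ∀ m : ℝ, (∀ z ∈ K₁, ‖h z‖ ≤ m) →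
        ∀ z ∈ K, ‖deriv h z‖ ≤ C * m := by
  obtain ⟨r, hr, hrD⟩ := hK.exists_cthickening_subset_open hD hKD
  refine ⟨Metric.cthickening r K, hK.cthickening, Metric.self_subset_cthickening _, hrD, r⁻¹,
    by positivity, fun h hh m hm z hz => ?_⟩
  have hsub : Metric.closedBall z r ⊆ Metric.cthickening r K :=
    Metric.closedBall_subset_cthickening hz r
  have := Complex.norm_deriv_le_of_forall_mem_sphere_norm_le hr
    ((hh.mono (hsub.trans hrD)).diffContOnCl_ball subset_rfl)
    fun w hw => hm w (hsub (Metric.sphere_subset_closedBall hw))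
  rwa [inv_mul_eq_div]

theorem hasDerivAt_sum_one_div_pow {D Γ : Set ℂ} (hΓD : Disjoint Γ D) (N : ℕ)
    {m : Multiset ℂ} (hm : ∀ ζ ∈ m, ζ ∈ Γ) :
    ∀ z ∈ D, HasDerivAt (fun z => (m.map fun ζ => 1 / (ζ - z) ^ N).sum)
      (N * (m.map fun ζ => 1 / (ζ - z) ^ (N + 1)).sum) z := by
  intro z hz
  induction m using Multiset.induction_on with
  | empty => simpa using hasDerivAt_const z (0 : ℂ)
  | cons ζ m ih =>
    have hζ : ζ - z ≠ 0 := fun h => Set.disjoint_left.1 hΓD (hm ζ (Multiset.mem_cons_self _ _))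
      (by rwa [sub_eq_zero.1 h])
    have h1 : HasDerivAt (fun z => 1 / (ζ - z) ^ N) (N * (1 / (ζ - z) ^ (N + 1))) z := by
      have h2 := ((hasDerivAt_id z).const_sub ζ).fun_pow N
      have h3 := (hasDerivAt_const z (1 : ℂ)).fun_div h2 (pow_ne_zero N hζ)
      convert! h3 using 1
      rcases N with _ | N
      · simp
      · simp only [id, Nat.add_sub_cancel, zero_mul]
        field_simp
        ring
    simp only [Multiset.map_cons, Multiset.sum_cons, mul_add]
    exact h1.fun_add (ih fun ξ hξ => hm ξ (Multiset.mem_cons_of_mem hξ))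

theorem exists_sum_one_div_lt {D Γ : Set ℂ} (hD : IsOpen D) (hΓD : Disjoint Γ D) {N : ℕ}
    (hN : 1 ≤ N) {ζ₀ : ℂ} (hζ₀ : ζ₀ ∈ Γ)
    (h : ApproximableByPolys Γ D fun z => 1 / (ζ₀ - z) ^ N) {K : Set ℂ} (hK : IsCompact K)
    (hKD : K ⊆ D) {ε : ℝ} (hε : 0 < ε) :
    ∃ m : Multiset ℂ, m ≠ 0 ∧ (∀ ζ ∈ m, ζ ∈ Γ) ∧
      ∀ z ∈ K, ‖(m.map fun ζ => 1 / (ζ - z)).sum‖ < ε := by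
  obtain ⟨K₁, hK₁, hKK₁, hK₁D, C, hC, hder⟩ := exists_norm_deriv_le hD hK hKD
  obtain ⟨M, hM0, hM⟩ : ∃ M : ℝ, 0 < M ∧ ∀ z ∈ K₁, ‖(ζ₀ - z) ^ N‖ ≤ M := by
    obtain ⟨M, hM⟩ := hK₁.exists_bound_of_continuousOn (f := fun z => (ζ₀ - z) ^ N) (by fun_prop)
    exact ⟨max M 1, lt_max_of_lt_right one_pos, fun z hz => (hM z hz).trans (le_max_left _ _)⟩
  -- With `‖Q - 1‖ ≤ e`, the first bound gives `‖Q‖ ≥ 1 / 2` and the second, by Cauchy's estimate,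
  -- `‖Q'‖ < ε / 2`.
  set e : ℝ := min (1 / 2) (ε / (2 * (C + 1))) with he
  have he0 : 0 < e := lt_min (by norm_num) (by positivity)
  obtain ⟨p, ⟨hp0, hpΓ⟩, hpK⟩ := h K₁ hK₁ hK₁D (e / M) (by positivity)
  let Q : Polynomial ℂ := p * (Polynomial.C ζ₀ - Polynomial.X) ^ N
  have hX : (Polynomial.C ζ₀ - Polynomial.X : Polynomial ℂ) ≠ 0 := by
    rw [← neg_sub, neg_ne_zero]; exact Polynomial.X_sub_C_ne_zero _
  have hQ0 : Q ≠ 0 := mul_ne_zero hp0 (pow_ne_zero _ hX)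
  have hQe : ∀ z, Q.eval z = p.eval z * (ζ₀ - z) ^ N := fun z => by simp [Q]
  have hQ1 : ∀ z ∈ K₁, ‖Q.eval z - 1‖ ≤ e := by
    intro z hz
    have hne : (ζ₀ - z) ^ N ≠ 0 := pow_ne_zero _ fun h0 =>
      Set.disjoint_left.1 hΓD hζ₀ (by rw [sub_eq_zero.1 h0]; exact hK₁D hz)
    have : Q.eval z - 1 = -((1 / (ζ₀ - z) ^ N - p.eval z) * (ζ₀ - z) ^ N) := by
      rw [hQe]; field_simp; ring
    rw [this, norm_neg, norm_mul]
    calc _ ≤ e / M * M := by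
          gcongr
          · exact (hpK z hz).le
          · exact hM z hz
      _ = e := div_mul_cancel₀ _ hM0.ne'
  refine ⟨Q.roots, ?_, fun ζ hζ => ?_, fun z hz => ?_⟩
  · intro h0
    have : ζ₀ ∈ Q.roots := (Polynomial.mem_roots hQ0).2 (by
      rw [Polynomial.IsRoot, hQe, sub_self, zero_pow (by omega), mul_zero])
    rw [h0] at this
    exact Multiset.notMem_zero _ this
  · have h1 := (Polynomial.mem_roots hQ0).1 hζ
    rw [Polynomial.IsRoot, hQe] at h1
    rcases mul_eq_zero.1 h1 with h2 | h2
    · exact hpΓ ζ h2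
    · rw [← sub_eq_zero.1 (pow_eq_zero_iff (by omega) |>.1 h2)]
      exact hζ₀
  · have hd := hder (fun z => Q.eval z - 1) (Q.differentiable.differentiableOn.sub_const _) e hQ1 z hz
    rw [deriv_sub_const, Polynomial.deriv] at hd
    have h1 := hQ1 z (hKK₁ hz)
    have h2 : 1 / 2 ≤ ‖Q.eval z‖ := by
      have h3 : ‖(1 : ℂ)‖ ≤ ‖Q.eval z‖ + ‖Q.eval z - 1‖ := by
        simpa using norm_sub_le (Q.eval z) (Q.eval z - 1)
      rw [norm_one] at h3
      linarith [min_le_left (1 / 2) (ε / (2 * (C + 1)))]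
    have h0 : Q.eval z ≠ 0 := norm_pos_iff.1 (by linarith)
    rw [← norm_neg, ← Polynomial.eval_derivative_div_eval_eq_neg_sum h0, norm_div,
      div_lt_iff₀ (by linarith)]
    have h4 : C * e < ε / 2 := by
      calc C * e ≤ C * (ε / (2 * (C + 1))) := by gcongr; exact min_le_right _ _
        _ < ε / 2 := by
          rw [mul_div_assoc', div_lt_iff₀ (by positivity)]
          nlinarith
    nlinarith

/-- Differentiation raises the exponent by one with the same poles, and Cauchy's estimate preserves
smallness. -/
theorem exists_sum_one_div_pow_lt {D Γ : Set ℂ} (hD : IsOpen D) (hΓD : Disjoint Γ D)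
    (h1 : ∀ K : Set ℂ, IsCompact K → K ⊆ D → ∀ ε : ℝ, 0 < ε → ∃ m : Multiset ℂ, m ≠ 0 ∧
      (∀ ζ ∈ m, ζ ∈ Γ) ∧ ∀ z ∈ K, ‖(m.map fun ζ => 1 / (ζ - z)).sum‖ < ε) {N : ℕ} (hN : 1 ≤ N) :
    ∀ K : Set ℂ, IsCompact K → K ⊆ D → ∀ ε : ℝ, 0 < ε → ∃ m : Multiset ℂ, m ≠ 0 ∧
      (∀ ζ ∈ m, ζ ∈ Γ) ∧ ∀ z ∈ K, ‖(m.map fun ζ => 1 / (ζ - z) ^ N).sum‖ < ε := by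
  induction N, hN using Nat.le_induction with
  | base => simpa using h1
  | succ N hN ih =>
    intro K hK hKD ε hε
    obtain ⟨K₁, hK₁, hKK₁, hK₁D, C, hC, hder⟩ := exists_norm_deriv_le hD hK hKD
    obtain ⟨m, hm0, hm, hmK⟩ := ih K₁ hK₁ hK₁D (ε / (C + 1)) (by positivity)
    refine ⟨m, hm0, hm, fun z hz => ?_⟩
    have hd := hasDerivAt_sum_one_div_pow hΓD N hm
    have h2 := hder _ (fun z hz => (hd z hz).differentiableAt.differentiableWithinAt) _
      (fun z hz => (hmK z hz).le) z hz
    rw [(hd z (hKD hz)).deriv, norm_mul, Complex.norm_natCast] at h2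
    have hN' : (1 : ℝ) ≤ N := by exact_mod_cast hN
    have h3 : C * (ε / (C + 1)) < ε := by
      rw [mul_div_assoc', div_lt_iff₀ (by positivity)]
      nlinarith
    nlinarith [norm_nonneg (m.map fun ζ => 1 / (ζ - z) ^ (N + 1)).sum]

/-- An open subset of the plane is exhausted by compact sets. -/
theorem IsOpen.exists_compact_exhaustion {D : Set ℂ} (hD : IsOpen D) :
    ∃ K : ℕ → Set ℂ, (∀ j, IsCompact (K j)) ∧ (∀ j, K j ⊆ D) ∧
      ∀ K' : Set ℂ, IsCompact K' → K' ⊆ D → ∀ᶠ j in Filter.atTop, K' ⊆ K j := by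
  refine ⟨fun j => Metric.closedBall 0 j ∩ {z | ENNReal.ofReal (1 / (j + 1)) ≤ Metric.infEDist z Dᶜ},
    fun j => ?_, fun j z hz => ?_, fun K' hK' hK'D => ?_⟩
  · exact (isCompact_closedBall _ _).inter_right
      (isClosed_le continuous_const Metric.continuous_infEDist)
  · by_contra hzD
    have h1 : ENNReal.ofReal (1 / (j + 1)) ≤ Metric.infEDist z Dᶜ := hz.2
    rw [Metric.infEDist_zero_of_mem (show z ∈ Dᶜ from hzD)] at h1
    have : (0 : ℝ) < 1 / (j + 1) := by positivity
    simp only [nonpos_iff_eq_zero, ENNReal.ofReal_eq_zero] at h1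
    linarith
  · obtain ⟨R, hR⟩ := hK'.isBounded.exists_norm_le
    obtain ⟨δ, hδ, hδD⟩ := hK'.exists_thickening_subset_open hD hK'D
    filter_upwards [Filter.eventually_ge_atTop ⌈R⌉₊,
      tendsto_one_div_add_atTop_nhds_zero_nat.eventually_lt_const hδ] with j hj hj' z hz
    refine ⟨mem_closedBall_zero_iff.2 ((hR z hz).trans (Nat.ceil_le.1 hj)), ?_⟩
    refine Metric.le_infEDist.2 fun y hy => ?_
    rw [edist_dist]
    refine ENNReal.ofReal_le_ofReal (hj'.le.trans ?_)
    by_contra! hlt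
    exact hy (hδD (Metric.mem_thickening_iff.2 ⟨z, hz, by rwa [dist_comm]⟩))

theorem containsAsympNeutral_of_approximable {D Γ : Set ℂ} (hD : IsOpen D) (hΓD : Disjoint Γ D)
    {N : ℕ} (hN : 1 ≤ N) {ζ₀ : ℂ} (hζ₀ : ζ₀ ∈ Γ)
    (h : ApproximableByPolys Γ D fun z => 1 / (ζ₀ - z) ^ N) : ContainsAsympNeutral N Γ D := by
  obtain ⟨K, hK, hKD, hexh⟩ := hD.exists_compact_exhaustion
  have hsum := exists_sum_one_div_pow_lt hD hΓD
    (fun K hK hKD ε hε => exists_sum_one_div_lt hD hΓD hN hζ₀ h hK hKD hε) hN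
  choose m hm0 hm hmK using fun j : ℕ => hsum (K j) (hK j) (hKD j) (1 / ((j : ℝ) + 1) ^ 2)
    (by positivity)
  -- Repeating each family `j + 1` times forces the lengths to infinity; the tolerance `1 / (j + 1)
  -- ^ 2` absorbs this factor.
  let s : ℕ → List ℂ := fun j => ((j + 1) • m j).toList
  refine ⟨fun j => (s j).length, fun j k => (s j).get k, fun j k => ?_, ?_, fun L hL hLD => ?_⟩
  · have h1 : (s j).get k ∈ (j + 1) • m j := Multiset.mem_toList.1 (List.get_mem _ _)
    exact hm j _ (Multiset.mem_of_mem_nsmul h1)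
  · refine Filter.tendsto_atTop_mono (fun j => ?_) Filter.tendsto_id
    have h1 : 0 < (m j).card := Multiset.card_pos.2 (hm0 j)
    simp only [s, Multiset.length_toList, Multiset.card_nsmul, id]
    nlinarith
  · rw [Metric.tendstoUniformlyOn_iff]
    intro ε hε
    filter_upwards [hexh L hL hLD,
      tendsto_one_div_add_atTop_nhds_zero_nat.eventually_lt_const hε] with j hj hj' z hz
    have h1 : ∑ k : Fin (s j).length, 1 / ((s j).get k - z) ^ N =
        (j + 1) * ((m j).map fun ζ => 1 / (ζ - z) ^ N).sum := by
      have h2 := Fin.sum_univ_fun_getElem (s j) fun ζ => 1 / (ζ - z) ^ N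
      simp only [List.get_eq_getElem]
      rw [h2, ← Multiset.sum_coe, ← Multiset.map_coe, Multiset.coe_toList, Multiset.map_nsmul,
        Multiset.sum_nsmul, nsmul_eq_mul]
      push_cast; rfl
    rw [dist_zero_left, h1, norm_mul]
    have h3 : ‖((j : ℂ) + 1)‖ = (j : ℝ) + 1 := by
      exact_mod_cast Complex.norm_natCast (j + 1)
    rw [h3]
    refine lt_of_le_of_lt ?_ hj'
    calc ((j : ℝ) + 1) * ‖((m j).map fun ζ => 1 / (ζ - z) ^ N).sum‖
        ≤ (j + 1) * (1 / ((j : ℝ) + 1) ^ 2) := by gcongr; exact (hmK j z (hj hz)).le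
      _ = 1 / (j + 1) := by field_simp

/-! ### From neutral families to separation -/

/-- Averages of evaluations have a limit functional along a free ultrafilter. -/
theorem exists_limit_of_averages {F : Set ℂ} [CompactSpace F] {n : ℕ → ℕ}
    (ζ : (j : ℕ) → Fin (n j) → F) (u : Ultrafilter ℕ) :
    ∃ Λ : C(F, ℂ) →L[ℂ] ℂ, ∀ g : C(F, ℂ),
      Filter.Tendsto (fun j => (n j : ℂ)⁻¹ * ∑ k, g (ζ j k)) u (nhds (Λ g)) := by
  let L : ℕ → C(F, ℂ) →L[ℂ] ℂ := fun j => (n j : ℂ)⁻¹ • ∑ k, ContinuousMap.evalCLM ℂ (ζ j k)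
  have hL : ∀ j g, L j g = (n j : ℂ)⁻¹ * ∑ k, g (ζ j k) := fun j g => by
    simp [L]
  have hnorm : ∀ j, ‖L j‖ ≤ 1 := fun j => by
    refine ContinuousLinearMap.opNorm_le_bound _ zero_le_one fun g => ?_
    rw [hL, norm_mul, norm_inv, Complex.norm_natCast, one_mul]
    have h1 : ‖∑ k, g (ζ j k)‖ ≤ n j * ‖g‖ := by
      simpa using norm_sum_le_of_le Finset.univ fun k _ => g.norm_coe_le_norm (ζ j k)
    rcases Nat.eq_zero_or_pos (n j) with h | h
    · simp [h]
    · have h2 : (0 : ℝ) < n j := by exact_mod_cast h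
      rwa [inv_mul_le_iff₀ h2]
  -- Banach–Alaoglu: the averages lie in the weak-* compact unit ball.
  have hcomp := WeakDual.isCompact_closedBall (𝕜 := ℂ) (E := C(F, ℂ)) 0 1
  obtain ⟨Λ, -, hΛ⟩ := hcomp.ultrafilter_le_nhds (u.map fun j => StrongDual.toWeakDual (L j)) (by
    rw [Filter.le_principal_iff]
    exact Filter.mem_map.2 (Filter.univ_mem' fun j => mem_closedBall_zero_iff.2 (hnorm j)))
  refine ⟨WeakDual.toStrongDual Λ, fun g => ?_⟩
  have h1 : Filter.Tendsto (fun j => StrongDual.toWeakDual (L j)) u (nhds Λ) := hΛ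
  have h2 := ((WeakDual.eval_continuous g).tendsto Λ).comp h1
  exact h2.congr fun j => hL j g

/-- Uses `z / (z - ξ) = 1 + ξ / (z - ξ)`; this normalises the limit potential at infinity. -/
theorem tendsto_smul_cauchyKernel_cobounded {F : Set ℂ} [CompactSpace F] :
    Filter.Tendsto (fun z : ℂ => z • cauchyKernel F z) (Bornology.cobounded ℂ) (nhds 1) := by
  have hF : IsCompact F := isCompact_iff_compactSpace.2 inferInstance
  have h1 : Filter.Tendsto (fun z : ℂ => 1 + coordFun F * cauchyKernel F z)
      (Bornology.cobounded ℂ) (nhds 1) := by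
    simpa using (tendsto_cauchyKernel_cobounded (K := F)).const_mul (coordFun F) |>.const_add 1
  refine h1.congr' ?_
  filter_upwards [Bornology.isBounded_def.1 hF.isBounded] with z hz
  ext ξ
  have hne : z - (ξ : ℂ) ≠ 0 := fun h => hz (by rw [sub_eq_zero.1 h]; exact ξ.2)
  have h2 : coordFun F ξ = ξ := rfl
  simp only [ContinuousMap.add_apply, ContinuousMap.one_apply, ContinuousMap.mul_apply,
    ContinuousMap.smul_apply, smul_eq_mul, cauchyKernel_apply hz, h2]
  field_simp
  ring

theorem isBounded_connectedComponentIn_of_containsAsympNeutral {D Γ : Set ℂ} {N : ℕ}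
    (hD : IsOpen D) (hc : IsPreconnected D) (hΓ : Bornology.IsBounded Γ) (hΓD : Disjoint Γ D)
    (h : ContainsAsympNeutral N Γ D) {p : ℂ} (hp : p ∈ D) :
    Bornology.IsBounded (connectedComponentIn (closure Γ)ᶜ p) := by
  obtain ⟨n, ζ, hζ, hn, hlim⟩ := h
  set F := closure Γ with hF
  have hFc : IsCompact F := hΓ.isCompact_closure
  have : CompactSpace F := isCompact_iff_compactSpace.1 hFc
  have hDF : D ⊆ Fᶜ := (hΓD.closure_left hD).subset_compl_left
  set Ω := connectedComponentIn Fᶜ p with hΩ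
  have hDΩ : D ⊆ Ω := hc.subset_connectedComponentIn hp hDF
  have hΩF : Ω ⊆ Fᶜ := connectedComponentIn_subset _ _
  have hΩo : IsOpen Ω := hFc.isClosed.isOpen_compl.connectedComponentIn
  let u : Ultrafilter ℕ := Filter.hyperfilter ℕ
  have hu : (u : Filter ℕ) ≤ Filter.atTop := Nat.hyperfilter_le_atTop
  obtain ⟨Λ, hΛ⟩ := exists_limit_of_averages
    (fun j k => (⟨ζ j k, subset_closure (hζ j k)⟩ : F)) u
  have hn1 : ∀ᶠ j in Filter.atTop, 1 ≤ n j := hn.eventually_ge_atTop 1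
  have hΛ1 : Λ 1 = 1 := by
    refine tendsto_nhds_unique (hΛ 1) (tendsto_const_nhds.congr' ?_)
    filter_upwards [hu hn1] with j hj
    have : (n j : ℂ) ≠ 0 := by exact_mod_cast (by omega : n j ≠ 0)
    simp [this]
  -- Here `z` is the pole and the points of `F` are the variable, the reverse of the neutral sums;
  -- hence the factor `(-1) ^ N` below.
  let G : ℂ → ℂ := fun z => Λ (cauchyKernel F z ^ N)
  have hGd : DifferentiableOn ℂ G Ω := fun z hz =>
    (Λ.differentiableAt.comp z
      ((differentiableAt_cauchyKernel (hΩF hz)).pow N)).differentiableWithinAt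
  have hGD : ∀ z ∈ D, G z = 0 := by
    intro z hz
    refine tendsto_nhds_unique (hΛ _) ?_
    have h1 := ((hlim {z} isCompact_singleton (Set.singleton_subset_iff.2 hz)).tendsto_at
      (Set.mem_singleton z)).const_mul ((-1 : ℂ) ^ N)
    rw [mul_zero] at h1
    refine Filter.Tendsto.mono_left (squeeze_zero_norm' ?_ (by simpa using h1.norm)) hu
    filter_upwards [hn1] with j hj
    have h2 : ∑ k : Fin (n j), (cauchyKernel F z ^ N) ⟨ζ j k, subset_closure (hζ j k)⟩ =
        (-1) ^ N * ∑ k, 1 / (ζ j k - z) ^ N := by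
      rw [Finset.mul_sum]
      refine Finset.sum_congr rfl fun k _ => ?_
      rw [ContinuousMap.pow_apply, cauchyKernel_apply (hDF hz), ← neg_sub (ζ j k), one_div_pow,
        neg_pow, one_div, one_div, mul_inv, ← inv_pow, inv_neg_one]
    have h3 : (1 : ℝ) ≤ n j := by exact_mod_cast hj
    rw [h2, norm_mul, norm_inv, Complex.norm_natCast]
    refine (mul_le_of_le_one_left (norm_nonneg _) (inv_le_one_of_one_le₀ h3)).trans_eq ?_
    simp
  have hG0 : Set.EqOn G 0 Ω := by
    refine (hGd.analyticOnNhd hΩo).eqOn_zero_of_preconnected_of_eventuallyEq_zero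
      isPreconnected_connectedComponentIn (hDΩ hp) ?_
    filter_upwards [hD.mem_nhds hp] with z hz using hGD z hz
  have ht : Filter.Tendsto (fun z : ℂ => z ^ N * G z) (Bornology.cobounded ℂ) (nhds 1) := by
    have h1 := (Λ.continuous.tendsto _).comp
      ((tendsto_smul_cauchyKernel_cobounded (F := F)).pow N)
    rw [one_pow, hΛ1] at h1
    refine h1.congr fun z => ?_
    simp [G, smul_pow]
  -- An unbounded `Ω` would contain points arbitrarily far out where `G = 0`, against `z ^ N * G z →
  -- 1`.
  by_contra hub
  have hfreq : ∃ᶠ z in Bornology.cobounded ℂ, z ∈ Ω := fun hev =>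
    hub (Bornology.isBounded_def.2 hev)
  have hne : ∀ᶠ z in Bornology.cobounded ℂ, z ^ N * G z ≠ 0 := ht.eventually_ne one_ne_zero
  obtain ⟨z, hz, hz'⟩ := (hfreq.and_eventually hne).exists
  exact hz' (by rw [hG0 hz]; simp)

theorem dividesPlane_of_liesInBoundedComponent {D F : Set ℂ} (hF : IsCompact F)
    (h : LiesInBoundedComponent D F) : DividesPlane F := by
  obtain ⟨w, hw, hb, -⟩ := h
  intro hc
  rw [hc.connectedComponentIn hw] at hb
  have h1 : Bornology.IsBounded (Set.univ : Set ℂ) := by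
    rw [← Set.union_compl_self F]; exact hF.isBounded.union hb
  exact noncompact_univ ℂ (Metric.isCompact_of_isClosed_isBounded isClosed_univ h1)

/-! ### The equivalence -/

theorem theorem1p2 (D Γ : Set ℂ) (N : ℕ)
    (hD_open : IsOpen D) (hD_sc : IsSimplyConnected D) (hD_bdd : Bornology.IsBounded D)
    (hΓ_ne : Γ.Nonempty) (hΓ_bdd : Bornology.IsBounded Γ) (hΓD : Disjoint Γ D)
    (hN : 1 ≤ N) :
    List.TFAE [
      IsPolyApproxSet Γ D,
      ∀ ζ ∈ Γ, ApproximableByPolys Γ D (fun z => 1 / (ζ - z) ^ N),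
      ContainsAsympNeutral N Γ D,
      DividesPlane (closure Γ) ∧ LiesInBoundedComponent D (closure Γ)] := by
  tfae_have 1 → 2 := fun h ζ hζ => by
    have hne : ∀ z ∈ D, (ζ - z) ^ N ≠ 0 := fun z hz => pow_ne_zero _ fun h0 =>
      Set.disjoint_left.1 hΓD hζ (by rwa [sub_eq_zero.1 h0])
    refine h _ (fun z hz => ?_) fun z hz => one_div_ne_zero (hne z hz)
    have := hne z hz
    exact DifferentiableAt.differentiableWithinAt (by fun_prop (disch := assumption))
  tfae_have 2 → 3 := fun h => by
    obtain ⟨ζ₀, hζ₀⟩ := hΓ_ne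
    exact containsAsympNeutral_of_approximable hD_open hΓD hN hζ₀ (h ζ₀ hζ₀)
  tfae_have 3 → 4 := fun h => by
    obtain ⟨p, hp⟩ := hD_sc.nonempty
    have hc : IsPreconnected D := hD_sc.isPathConnected.isConnected.isPreconnected
    have hDF : D ⊆ (closure Γ)ᶜ := (hΓD.closure_left hD_open).subset_compl_left
    have hL : LiesInBoundedComponent D (closure Γ) := ⟨p, hDF hp,
      isBounded_connectedComponentIn_of_containsAsympNeutral hD_open hc hΓ_bdd hΓD h hp,
      hc.subset_connectedComponentIn hp hDF⟩
    exact ⟨dividesPlane_of_liesInBoundedComponent hΓ_bdd.isCompact_closure hL, hL⟩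
  tfae_have 4 → 1 := fun h =>
    isPolyApproxSet_of_liesInBoundedComponent hD_open hD_sc hΓ_bdd hΓD h.2
  tfae_finish
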